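/- Let $X$ be a normal toric variety of dimension $n$ over $\mathbb C$: a normal integral separated scheme of finite type over $\mathbb C$ (for instance a projective one) with an algebraic action of the torus $T=(\mathbb C^*)^n$ and a base point $x_X$ whose orbit map $t\mapsto t\cdot x_X$ is an isomorphism of $T$ onto a Zariski open subset $U$, the principal orbit. A toric morphism $Y\to X$ of such varieties is a morphism over $\mathbb C$ that maps base point to base point and is equivariant along a homomorphism of algebraic groups $(\mathbb C^*)^n\to(\mathbb C^*)^n$. A toric cover of $X$ is a finite toric morphism $f:Y\to X$ from a normal toric variety $Y$ of dimension $n$ whose principal orbit is $f^{-1}(U)$; it is equivariant along a homomorphism $\varphi_Y:(\mathbb C^*)^n\to(\mathbb C^*)^n$. The proalgebraic toric completion $X_{\mathbb Q}$ is the inverse limit, with the inverse limit topology, of the spaces $Y(\mathbb C)$ with their analytic topology, over all toric covers $Y\to X$ and all toric morphisms over $X$ between them; $p_Y:X_{\mathbb Q}\to Y(\mathbb C)$ denotes the projections. Let $\mathbb C^*_{\mathbb Q}$ be the topological group $\varprojlim \mathbb C^*$, the limit being over the positive integers ordered by divisibility, with the maps $z\mapsto z^{m/k}$ for $k\mid m$,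 and let $\pi_1:(\mathbb C^*_{\mathbb Q})^n\to(\mathbb C^*)^n$ be the projection to the level $1$. Then there is a continuous action of $(\mathbb C^*_{\mathbb Q})^n$ on $X_{\mathbb Q}$ such that: 1. for every toric cover $Y\to X$ there is a continuous surjective homomorphism $\pi_Y:(\mathbb C^*_{\mathbb Q})^n\to(\mathbb C^*)^n$ with $\varphi_Y\circ\pi_Y=\pi_1$ and $p_Y(g\cdot x)=\pi_Y(g)\cdot p_Y(x)$ for all $g\in(\mathbb C^*_{\mathbb Q})^n$ and $x\in X_{\mathbb Q}$; 2. the action has a dense principal orbit: the set $p_X^{-1}(U(\mathbb C))$ is a single orbit, it is open and dense in $X_{\mathbb Q}$, and for some point $x_0$ of it the orbit map $g\mapsto g\cdot x_0$ is a homeomorphism of $(\mathbb C^*_{\mathbb Q})^n$ onto it. -/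

import Mathlib

open CategoryTheory MonoidalCategory CartesianMonoidalCategory AlgebraicGeometry
open scoped MonObj

noncomputable section

namespace ProalgebraicToric

/-! ### Complex points and the analytic topology -/

/-- The base `Spec ℂ`. -/
abbrev SpecC : Scheme.{0} := Spec (.of ℂ)

/-- The set `X(ℂ)` of complex points of a `ℂ`-scheme: sections `Spec ℂ ⟶ X` of its structure
morphism. -/
def Points (X : Over SpecC) : Type := 𝟙_ (Over SpecC) ⟶ X

/-- The map `X(ℂ) → Y(ℂ)` induced by a morphism of `ℂ`-schemes. -/
def Points.map {X Y : Over SpecC} (f : X ⟶ Y) (x : Points X) : Points Y :=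
  CategoryStruct.comp (X := 𝟙_ (Over SpecC)) x f

/-- The underlying morphism of schemes `Spec ℂ ⟶ X` of a complex point. -/
def Points.hom {X : Over SpecC} (x : Points X) : SpecC ⟶ X.left :=
  CommaMorphism.left (X := 𝟙_ (Over SpecC)) x

/-- A complex point lies in the Zariski open `U`. -/
def Points.Mem {X : Over SpecC} (x : Points X) (U : X.left.Opens) : Prop :=
  ⊤ ≤ x.hom ⁻¹ᵁ U

/-- The value `f(x) ∈ ℂ` of a regular function `f ∈ Γ(U, 𝒪_X)` at a complex point `x ∈ U(ℂ)`. -/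
def Points.value {X : Over SpecC} (x : Points X) {U : X.left.Opens} (hx : x.Mem U)
    (f : Γ(X.left, U)) : ℂ :=
  (Scheme.ΓSpecIso (.of ℂ)).hom (x.hom.appLE U ⊤ hx f)

/-- The analytic (classical) topology on `X(ℂ)`: the coarsest topology for which every `U(ℂ)`,
`U` Zariski open, is open and every regular function `U(ℂ) → ℂ` is continuous there. -/
instance (X : Over SpecC) : TopologicalSpace (Points X) :=
  TopologicalSpace.generateFrom
    {s | ∃ (U : X.left.Opens) (f : Γ(X.left, U)) (W : Set ℂ), IsOpen W ∧
      s = {x : Points X | ∃ hx : x.Mem U, x.value hx f ∈ W}}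

/-- The complex points of a group scheme over `ℂ` form a group. -/
instance (G : Over SpecC) [GrpObj G] : Group (Points G) :=
  inferInstanceAs (Group (𝟙_ (Over SpecC) ⟶ G))

/-! ### The algebraic torus -/

/-- The `n`-dimensional algebraic torus `𝔾ₘⁿ = Spec ℂ[ℤⁿ]` as a `ℂ`-scheme. -/
abbrev torus (n : ℕ) : Over SpecC :=
  (Spec (.of (MonoidAlgebra ℂ (Multiplicative (Fin n → ℤ))))).asOver SpecC

/-- The character `m ↦ ∏ uᵢ ^ mᵢ` of the lattice `ℤⁿ` given by `u ∈ (ℂ*)ⁿ`. -/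
def latticeChar {n : ℕ} (u : Fin n → ℂˣ) : Multiplicative (Fin n → ℤ) →* ℂ where
  toFun m := ((∏ i, u i ^ (m.toAdd i) : ℂˣ) : ℂ)
  map_one' := by simp
  map_mul' a b := by simp [zpow_add, Finset.prod_mul_distrib]

/-- The point of the torus with coordinates `u ∈ (ℂ*)ⁿ`, that is, the homomorphism of algebras
`ℂ[ℤⁿ] → ℂ` sending the `i`-th coordinate function to `uᵢ`. -/
def torusPoint {n : ℕ} (u : Fin n → ℂˣ) : Points (torus n) :=
  Over.homMk (U := 𝟙_ (Over SpecC)) (V := torus n)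
    (Spec.map (CommRingCat.ofHom
      (MonoidAlgebra.lift ℂ ℂ (Multiplicative (Fin n → ℤ)) (latticeChar u)).toRingHom))
    (by
      change Spec.map _ ≫ Spec.map _ = 𝟙 _
      rw [← Spec.map_comp, ← CommRingCat.ofHom_comp, ← Spec.map_id]
      congr 1
      ext z
      simp)

/-! ### Normal toric varieties -/

/-- A normal complex toric variety of dimension `n`: a normal integral separated scheme of finite
type over `ℂ` with an algebraic action of the torus `(ℂ*)ⁿ` and an open principal orbit
`U ≅ (ℂ*)ⁿ`. The orbit is recorded by its orbit map `t ↦ t · x₀` for a base point `x₀ ∈ U`; it is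
dense since the variety is irreducible. -/
structure ToricVariety (n : ℕ) where
  /-- the underlying scheme over `ℂ` -/
  X : Over SpecC
  integral : IsIntegral X.left
  separated : IsSeparated X.hom
  finiteType : LocallyOfFiniteType X.hom
  quasiCompact : QuasiCompact X.hom
  normal : ∀ x : X.left, IsIntegrallyClosed (X.left.presheaf.stalk x)
  /-- the action of the torus: an action morphism satisfying the unit and associativity laws -/
  action : ModObj (torus n) X
  /-- the orbit map of the principal orbit -/
  orbit : torus n ⟶ X
  isOpenImmersion : IsOpenImmersion orbit.left
  orbit_equivariant : μ[torus n] ≫ orbit = (torus n ◁ orbit) ≫ action.smul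

namespace ToricVariety

variable {n : ℕ}

/-- The action morphism `(ℂ*)ⁿ × X ⟶ X`. -/
def act (X : ToricVariety n) : torus n ⊗ X.X ⟶ X.X := X.action.smul

/-- The principal orbit `U`, as a Zariski open of `X`. -/
def principalOrbit (X : ToricVariety n) : X.X.left.Opens :=
  haveI := X.isOpenImmersion
  X.orbit.left.opensRange

/-- The action of `T(ℂ) = (ℂ*)ⁿ` on `X(ℂ)`. -/
def smul (X : ToricVariety n) (t : Points (torus n)) (x : Points X.X) : Points X.X :=
  CategoryStruct.comp (X := 𝟙_ (Over SpecC))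
    (lift (T := 𝟙_ (Over SpecC)) (X := torus n) (Y := X.X) t x) X.act

end ToricVariety

/-- A toric morphism `Y ⟶ X`: a morphism of `ℂ`-schemes mapping base point to base point and
equivariant along a homomorphism `(ℂ*)ⁿ → (ℂ*)ⁿ` of algebraic groups. -/
structure ToricHom {n : ℕ} (Y X : ToricVariety n) where
  f : Y.X ⟶ X.X
  φ : torus n ⟶ torus n
  isMonHom : IsMonHom φ
  orbit_comp : Y.orbit ≫ f = φ ≫ X.orbit
  equivariant : Y.act ≫ f = (φ ⊗ₘ f) ≫ X.act

/-- The identity toric morphism. -/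
def ToricHom.id {n : ℕ} (X : ToricVariety n) : ToricHom X X where
  f := 𝟙 _
  φ := 𝟙 _
  isMonHom := inferInstance
  orbit_comp := by simp
  equivariant := by simp

/-! ### Toric covers and the proalgebraic toric completion -/

/-- A toric cover `f : Y ⟶ X` of a normal toric variety: a finite morphism from a normal toric
variety `Y` of the same dimension, equivariant for the actions of `(ℂ*)ⁿ`, and such that the
principal orbit of `Y` is `f⁻¹(U)`, `U` the principal orbit of `X`. Over `U` such an `f` is
identified with a finite homomorphism `φ` of `n`-dimensional tori, so that it is an unramified
covering there and the branch locus lies in `X - U`. Covers are pointed (the base point of `Y`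
lies over that of `X`), as one needs to relate them to subgroups of `π₁(U)` and to have canonical
maps between them. -/
structure ToricCover {n : ℕ} (X : ToricVariety n) where
  Y : ToricVariety n
  toHom : ToricHom Y X
  finite : IsFinite toHom.f.left
  preimage : toHom.f.left ⁻¹ᵁ X.principalOrbit = Y.principalOrbit

/-- The trivial toric cover `X ⟶ X`. -/
def ToricCover.trivial {n : ℕ} (X : ToricVariety n) : ToricCover X where
  Y := X
  toHom := .id X
  finite := by
    change IsFinite (𝟙 X.X.left)
    infer_instance
  preimage := rfl

/-- The proalgebraic toric completion `X_ℚ`: the inverse limit of the spaces `Y(ℂ)` over all toric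
covers `Y ⟶ X` and all toric morphisms between them over `X`. -/
def Completion {n : ℕ} (X : ToricVariety n) : Type 1 :=
  {x : (c : ToricCover X) → Points c.Y.X //
    ∀ (c d : ToricCover X) (h : ToricHom c.Y d.Y), h.f ≫ d.toHom.f = c.toHom.f →
      (x c).map h.f = x d}

/-- The inverse limit topology on `X_ℚ`. -/
instance {n : ℕ} (X : ToricVariety n) : TopologicalSpace (Completion X) :=
  inferInstanceAs (TopologicalSpace (Subtype _))

/-- The projection of `X_ℚ` to a toric cover. -/
def Completion.proj {n : ℕ} {X : ToricVariety n} (c : ToricCover X) (x : Completion X) :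
    Points c.Y.X := x.1 c

/-! ### The adelic torus -/

/-- The algebraic solenoidal group `ℂ*_ℚ`: the inverse limit, over the positive integers ordered by
divisibility, of copies of `ℂ*` with the maps `z ↦ z ^ (m / k)` for `k ∣ m`. It carries the topology
and group structure induced from the product. -/
def solenoid : Subgroup (ℕ+ → ℂˣ) where
  carrier := {z | ∀ k l : ℕ+, z (k * l) ^ (l : ℕ) = z k}
  one_mem' _ _ := by simp
  mul_mem' {a b} ha hb k l := by simp [mul_pow, ha k l, hb k l]
  inv_mem' {a} ha k l := by simp [ha k l]

/-- The adelic torus `(ℂ*_ℚ)ⁿ`. -/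
abbrev AdelicTorus (n : ℕ) : Type := Fin n → solenoid

/-- The canonical projection `(ℂ*_ℚ)ⁿ → (ℂ*)ⁿ` to the first level, with values in the complex points
of the torus. -/
def AdelicTorus.proj {n : ℕ} (g : AdelicTorus n) : Points (torus n) :=
  torusPoint fun i => (g i : ℕ+ → ℂˣ) 1

end ProalgebraicToric

end

open CategoryTheory MonoidalCategory CartesianMonoidalCategory AlgebraicGeometry
open scoped MonObj

/-! ### Complex points, regular functions and the analytic topology. -/

noncomputable section

namespace ProalgebraicToric

open Topology Filter

/-! ### Complex points and values of regular functions -/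

namespace Points

variable {X Y Z : Over SpecC}

/-! The covers that matter are the power covers: for `N ≥ 1`, let `X_N` be the normalization of `X`
in the torus along `t ↦ t ^ N` followed by the orbit map. For any toric cover `c`, the homomorphism
`φ` of tori is the base change of a finite morphism, hence finite, so it is dual to a lattice map
`α` with torsion cokernel; there are `β` and `N` with `αβ = βα = N`. By the universal property of
normalization, `X_N` then dominates `c` along the homomorphism dual to `β`.

Hence the projection of the adelic torus to level `N`, followed by the homomorphism dual to `β`,
lifts the projection to level `1` through `φ`. The lift is unique, because the kernel of `φ` is
killed by `N` and the adelic torus is divisible (`ToricCover.eq_lift`). Uniqueness makes the lifts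
compatible with all toric morphisms over `X`, so the adelic torus acts on the limit componentwise.

A point over the principal orbit has all its components in principal orbits. Its torus coordinates
on the power covers form a point of the solenoid to the `n`, which gives the single orbit and, since
orbit maps are open immersions, the homeomorphism. For density, a basic open set of the limit
involves finitely many covers; one power cover dominates them all, its principal orbit is
analytically dense, and every point of that orbit lifts to the adelic torus.

Two geometric inputs carry this. `X_N` must be a toric variety: finiteness of the normalization
comes from characteristic zero, and the action extends because normalization commutes with smooth
base change, here by the torus. And nonempty Zariski opens must be analytically dense
(`Points.dense_setOf_mem`): this follows from Noether normalization and the lifting of convergent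
families of points through finite extensions of normal domains (`exists_tendsto_lift`). -/

@[simp]
theorem map_id (x : Points X) : x.map (𝟙 X) = x := Category.comp_id (X := 𝟙_ (Over SpecC)) x

@[simp]
theorem map_comp (f : X ⟶ Y) (g : Y ⟶ Z) (x : Points X) :
    x.map (f ≫ g) = (x.map f).map g :=
  (Category.assoc (W := 𝟙_ (Over SpecC)) x f g).symm

theorem hom_map (f : X ⟶ Y) (x : Points X) : (x.map f).hom = x.hom ≫ f.left := rfl

theorem hom_comp (x : Points X) : x.hom ≫ X.hom = 𝟙 SpecC :=
  CommaMorphism.w (X := 𝟙_ (Over SpecC)) x |>.trans (Category.comp_id _)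

theorem hom_injective {x y : Points X} (h : x.hom = y.hom) : x = y :=
  Over.OverMorphism.ext (U := 𝟙_ (Over SpecC)) h

/-- The complex point with a given underlying section of the structure morphism. -/
def ofHom (f : SpecC ⟶ X.left) (hf : f ≫ X.hom = 𝟙 SpecC) : Points X :=
  Over.homMk (U := 𝟙_ (Over SpecC)) f hf

@[simp]
theorem hom_ofHom (f : SpecC ⟶ X.left) (hf : f ≫ X.hom = 𝟙 SpecC) :
    (ofHom f hf).hom = f := rfl

/-- The point of `Spec ℂ`. -/
def specPoint : SpecC := IsLocalRing.closedPoint ℂ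

theorem eq_specPoint (p : SpecC) : p = specPoint :=
  Subsingleton.elim (α := PrimeSpectrum ℂ) _ _

/-- The underlying point of the scheme of a complex point. -/
def pt (x : Points X) : X.left := x.hom specPoint

theorem pt_map (f : X ⟶ Y) (x : Points X) : (x.map f).pt = f.left x.pt := by
  rw [pt, hom_map, Scheme.Hom.comp_apply]
  rfl

theorem mem_iff (x : Points X) (U : X.left.Opens) : x.Mem U ↔ x.pt ∈ U := by
  constructor
  · intro h
    exact h (show specPoint ∈ (⊤ : SpecC.Opens) from trivial)
  · intro h p _
    rw [eq_specPoint p]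
    exact h

theorem Mem.top_le {x : Points X} {U : X.left.Opens} (hx : x.Mem U) : ⊤ ≤ x.hom ⁻¹ᵁ U := hx

theorem value_def (x : Points X) {U : X.left.Opens} (hx : x.Mem U) (s : Γ(X.left, U)) :
    x.value hx s = (Scheme.ΓSpecIso (.of ℂ)).hom (x.hom.appLE U ⊤ hx.top_le s) := rfl

theorem range_hom_subset {x : Points X} {U : X.left.Opens} (hx : x.Mem U) :
    Set.range x.hom ⊆ U := by
  rintro _ ⟨p, rfl⟩
  exact hx (show p ∈ (⊤ : SpecC.Opens) from trivial)

theorem Mem.mono {x : Points X} {U V : X.left.Opens} (hx : x.Mem U) (h : U ≤ V) : x.Mem V :=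
  (mem_iff _ _).2 (h ((mem_iff _ _).1 hx))

theorem mem_map_iff (f : X ⟶ Y) (x : Points X) (U : Y.left.Opens) :
    (x.map f).Mem U ↔ x.Mem (f.left ⁻¹ᵁ U) := by
  simp [mem_iff, pt_map]

/-- Evaluation of regular functions at a complex point, as a ring homomorphism. -/
def valueHom (x : Points X) {U : X.left.Opens} (hx : x.Mem U) : Γ(X.left, U) →+* ℂ :=
  (x.hom.appLE U ⊤ hx ≫ (Scheme.ΓSpecIso (.of ℂ)).hom).hom

theorem valueHom_apply (x : Points X) {U : X.left.Opens} (hx : x.Mem U) (s : Γ(X.left, U)) :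
    x.valueHom hx s = x.value hx s := rfl

theorem value_map (f : X ⟶ Y) (x : Points X) {U : Y.left.Opens} (hx : (x.map f).Mem U)
    {V : X.left.Opens} (hV : x.Mem V) (h : V ≤ f.left ⁻¹ᵁ U) (s : Γ(Y.left, U)) :
    (x.map f).value hx s = x.value hV (f.left.appLE U V h s) := by
  rw [value_def, value_def, ← ConcreteCategory.comp_apply (f.left.appLE U V h),
    Scheme.Hom.appLE_comp_appLE]
  rfl

theorem value_res (x : Points X) {U V : X.left.Opens} (hx : x.Mem V) (h : V ≤ U)
    (s : Γ(X.left, U)) :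
    x.value hx (X.left.presheaf.map (homOfLE h).op s) = x.value (hx.mono h) s := by
  rw [value_def, value_def, ← ConcreteCategory.comp_apply (X.left.presheaf.map _),
    Scheme.Hom.map_appLE]

theorem mem_basicOpen_iff (x : Points X) {U : X.left.Opens} (hx : x.Mem U) (s : Γ(X.left, U)) :
    x.Mem (X.left.basicOpen s) ↔ x.value hx s ≠ 0 := by
  have h0 : x.Mem (X.left.basicOpen s) ↔
      specPoint ∈ x.hom ⁻¹ᵁ X.left.basicOpen s := mem_iff _ _
  rw [h0, Scheme.Hom.preimage_basicOpen]
  have h1 : SpecC.basicOpen (x.hom.appLE U ⊤ hx.top_le s) =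
      SpecC.basicOpen (x.hom.app U s) := by
    have : x.hom.appLE U ⊤ hx.top_le s =
      SpecC.presheaf.map (homOfLE hx.top_le).op (x.hom.app U s) := rfl
    rw [this, Scheme.basicOpen_res]
    exact inf_eq_right.2 le_top
  -- The only prime of `ℂ` is zero, so lying in a basic open of `Spec ℂ` means being a nonzero
  -- number.
  rw [← h1, basicOpen_eq_of_affine']
  change x.value hx s ∉ (IsLocalRing.closedPoint ℂ).asIdeal ↔ _
  simp [IsLocalRing.closedPoint, IsLocalRing.maximalIdeal_eq_bot]

open Classical in
/-- The value of a regular function on `U` at a complex point, extended by `0` outside `U(ℂ)`. -/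
def eval (x : Points X) (U : X.left.Opens) (s : Γ(X.left, U)) : ℂ :=
  if h : x.Mem U then x.value h s else 0

theorem eval_of_mem {x : Points X} {U : X.left.Opens} (h : x.Mem U) (s : Γ(X.left, U)) :
    x.eval U s = x.value h s := dif_pos h

/-! ### The analytic topology -/

theorem isOpen_setOf_value_mem (U : X.left.Opens) (s : Γ(X.left, U)) {W : Set ℂ}
    (hW : IsOpen W) : IsOpen {x : Points X | ∃ hx : x.Mem U, x.value hx s ∈ W} :=
  TopologicalSpace.isOpen_generateFrom_of_mem ⟨U, s, W, hW, rfl⟩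

theorem isOpen_setOf_mem (U : X.left.Opens) : IsOpen {x : Points X | x.Mem U} := by
  convert isOpen_setOf_value_mem U 0 isOpen_univ using 1
  ext x
  simp

theorem continuousAt_eval {x : Points X} {U : X.left.Opens} (hx : x.Mem U) (s : Γ(X.left, U)) :
    ContinuousAt (fun y : Points X => y.eval U s) x := by
  rw [ContinuousAt, eval_of_mem hx, tendsto_nhds]
  intro W hW hxW
  filter_upwards [(isOpen_setOf_value_mem U s hW).mem_nhds ⟨hx, hxW⟩] with y hy
  obtain ⟨h, h'⟩ := hy
  simpa [eval_of_mem h] using h'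

theorem continuous_map (f : X ⟶ Y) : Continuous (Points.map f) := by
  refine continuous_generateFrom_iff.2 ?_
  rintro _ ⟨U, s, W, hW, rfl⟩
  convert isOpen_setOf_value_mem (f.left ⁻¹ᵁ U) (f.left.app U s) hW using 1
  ext x
  simp only [Set.mem_preimage, Set.mem_ofPred_eq]
  refine exists_congr fun h => ?_
  rw [value_map f x h ((mem_map_iff _ _ _).1 h) le_rfl, Scheme.Hom.app_eq_appLE]

/-- Near a complex point of an affine open, a regular function is a quotient of regular functions
on the affine open. -/
theorem exists_value_eq_div {V : X.left.Opens} (hV : IsAffineOpen V) {x : Points X} (hxV : x.Mem V)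
    {U : X.left.Opens} (hxU : x.Mem U) (s : Γ(X.left, U)) :
    ∃ (h k : Γ(X.left, V)) (m : ℕ), x.value hxV h ≠ 0 ∧
      ∀ (y : Points X) (hy : y.Mem V), y.value hy h ≠ 0 →
        ∃ hyU : y.Mem U, y.value hyU s = y.value hy k / y.value hy h ^ m := by
  obtain ⟨h, hU, hx⟩ := hV.exists_basicOpen_le ⟨x.pt, (mem_iff _ _).1 hxU⟩ ((mem_iff _ _).1 hxV)
  have := hV.isLocalization_basicOpen h
  obtain ⟨m, k, hk⟩ := IsLocalization.Away.surj h (X.left.presheaf.map (homOfLE hU).op s)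
  refine ⟨h, k, m, (mem_basicOpen_iff x hxV h).1 ((mem_iff _ _).2 hx), fun y hy hne => ?_⟩
  have hyD := (mem_basicOpen_iff y hy h).2 hne
  refine ⟨hyD.mono hU, ?_⟩
  rw [eq_div_iff (pow_ne_zero _ hne)]
  have := congrArg (y.valueHom hyD) hk
  rw [map_mul, map_pow] at this
  have e (a : Γ(X.left, V)) : y.valueHom hyD (algebraMap _ _ a) = y.value hy a :=
    y.value_res hyD (X.left.basicOpen_le h) a
  rw [e, e] at this
  rw [← this, valueHom_apply, value_res]

/-- The topology involves functions on all Zariski opens, but near a point of an affine `V` each of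
them is a quotient of functions on `V`; so functions on `V` suffice to test continuity. -/
theorem continuousAt_of_eval {A : Type*} [TopologicalSpace A] {g : A → Points X} {a : A}
    {V : X.left.Opens} (hV : IsAffineOpen V) (hg : ∀ᶠ b in 𝓝 a, (g b).Mem V)
    (h : ∀ s : Γ(X.left, V), ContinuousAt (fun b => (g b).eval V s) a) : ContinuousAt g a := by
  have ha : (g a).Mem V := hg.self_of_nhds
  rw [ContinuousAt, TopologicalSpace.tendsto_nhds_generateFrom_iff]
  rintro _ ⟨U, s, W, hW, rfl⟩ ⟨hU, hmem⟩
  obtain ⟨f, k, m, hne, H⟩ := exists_value_eq_div hV ha hU s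
  have hf : (g a).eval V f ≠ 0 := by rwa [eval_of_mem ha]
  have c1 : ContinuousAt (fun b => (g b).eval V k / (g b).eval V f ^ m) a :=
    (h k).div ((h f).pow m) (pow_ne_zero _ hf)
  have hW' : (g a).eval V k / (g a).eval V f ^ m ∈ W := by
    obtain ⟨h1, h2⟩ := H (g a) ha hne
    rwa [eval_of_mem ha, eval_of_mem ha, ← h2]
  filter_upwards [hg, (h f).eventually_ne hf, c1.eventually_mem (hW.mem_nhds hW')] with b hb hb' hbW
  rw [eval_of_mem hb] at hb'
  obtain ⟨h1, h2⟩ := H (g b) hb hb'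
  refine ⟨h1, ?_⟩
  rwa [h2, ← eval_of_mem hb, ← eval_of_mem hb]

theorem continuous_of_eval_top [IsAffine X.left] {A : Type*} [TopologicalSpace A] {g : A → Points X}
    (h : ∀ s : Γ(X.left, ⊤), Continuous (fun b => (g b).eval ⊤ s)) : Continuous g :=
  continuous_iff_continuousAt.2 fun _ => continuousAt_of_eval (isAffineOpen_top _)
    (Eventually.of_forall fun _ => (mem_iff _ _).2 trivial) fun s => (h s).continuousAt

/-! ### Open immersions -/

section OpenImmersion

variable (f : X ⟶ Y) [IsOpenImmersion f.left]

theorem map_injective : Function.Injective (Points.map f) :=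
  fun _ _ h => hom_injective ((cancel_mono f.left).1 (congrArg hom h))

theorem range_map : Set.range (Points.map f) = {y | y.Mem f.left.opensRange} := by
  ext y
  constructor
  · rintro ⟨x, rfl⟩
    rw [Set.mem_ofPred_eq, mem_iff, pt_map]
    exact ⟨_, rfl⟩
  · intro hy
    have hr : Set.range y.hom ⊆ Set.range f.left := range_hom_subset hy
    refine ⟨ofHom (IsOpenImmersion.lift f.left y.hom hr) ?_, hom_injective ?_⟩
    · rw [← Over.w f, IsOpenImmersion.lift_fac_assoc]
      exact y.hom_comp
    · rw [hom_map, hom_ofHom, IsOpenImmersion.lift_fac]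

/-- A regular function on an open of `X` is one on its image in `Y`, so the subbasic open sets of
`X` are induced from `Y`. -/
theorem isOpenEmbedding_map : IsOpenEmbedding (Points.map f) := by
  refine ⟨⟨⟨le_antisymm (continuous_map f).le_induced ?_⟩, map_injective f⟩, ?_⟩
  · refine le_generateFrom ?_
    rintro _ ⟨U, s, W, hW, rfl⟩
    refine ⟨_, isOpen_setOf_value_mem (f.left ''ᵁ U) ((f.left.appIso U).inv s) hW, ?_⟩
    ext x
    simp only [Set.mem_preimage, Set.mem_ofPred_eq]
    have hm : (x.map f).Mem (f.left ''ᵁ U) ↔ x.Mem U := by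
      rw [mem_map_iff, Scheme.Hom.preimage_image_eq]
    have hle : U ≤ f.left ⁻¹ᵁ f.left ''ᵁ U := (Scheme.Hom.preimage_image_eq f.left U).ge
    have hv (h : x.Mem U) : (x.map f).value (hm.2 h) ((f.left.appIso U).inv s) = x.value h s := by
      rw [value_map f x (hm.2 h) h hle, ← ConcreteCategory.comp_apply,
        Scheme.Hom.appIso_inv_appLE, value_res]
    constructor
    · rintro ⟨h, h'⟩
      exact ⟨hm.1 h, by rwa [← hv]⟩
    · rintro ⟨h, h'⟩
      exact ⟨hm.2 h, by rwa [hv]⟩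
  · rw [range_map]
    exact isOpen_setOf_mem _

end OpenImmersion

end Points

end ProalgebraicToric

end

/-! ### Products and continuity of the torus action. -/

noncomputable section

namespace ProalgebraicToric

open Topology Filter

/-! ### Points of a product -/

/-- The universal property gives a map from `D` to the subring that is a section of the inclusion,
so the inclusion is onto. It is applied to the functions on a product of affine opens. -/
theorem closure_range_union_of_isPushout {A B C D : CommRingCat} {f : A ⟶ B} {g : A ⟶ C}
    {i : B ⟶ D} {j : C ⟶ D} (h : IsPushout f g i j) :
    Subring.closure (Set.range i ∪ Set.range j) = ⊤ := by
  set S : Subring D := Subring.closure (Set.range i ∪ Set.range j) with hS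
  have hi (b : B) : i b ∈ S := Subring.subset_closure (Or.inl ⟨b, rfl⟩)
  have hj (c : C) : j c ∈ S := Subring.subset_closure (Or.inr ⟨c, rfl⟩)
  let i' : B ⟶ .of S := CommRingCat.ofHom (i.hom.codRestrict S hi)
  let j' : C ⟶ .of S := CommRingCat.ofHom (j.hom.codRestrict S hj)
  have hw : f ≫ i' = g ≫ j' := by
    ext a
    exact congrArg (fun k : A ⟶ D => k a) h.w
  have hid : h.desc i' j' hw ≫ CommRingCat.ofHom S.subtype = 𝟙 D := by
    refine h.hom_ext ?_ ?_
    · rw [h.inl_desc_assoc, Category.comp_id]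
      rfl
    · rw [h.inr_desc_assoc, Category.comp_id]
      rfl
  refine (Subring.eq_top_iff' S).2 fun d => ?_
  have hd : ((h.desc i' j' hw d : S) : D) = d := congrArg (fun k : D ⟶ D => k d) hid
  rw [← hd]
  exact (h.desc i' j' hw d : S).2

namespace Points

variable {X Y : Over SpecC}

/-- The point of a product with given components. -/
def pair (x : Points X) (y : Points Y) : Points (X ⊗ Y) :=
  CartesianMonoidalCategory.lift (T := 𝟙_ (Over SpecC)) x y

@[simp]
theorem pair_map_fst (x : Points X) (y : Points Y) : (pair x y).map (fst X Y) = x :=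
  lift_fst (T := 𝟙_ (Over SpecC)) x y

@[simp]
theorem pair_map_snd (x : Points X) (y : Points Y) : (pair x y).map (snd X Y) = y :=
  lift_snd (T := 𝟙_ (Over SpecC)) x y

theorem pair_map_tensorHom {X' Y' : Over SpecC} (f : X ⟶ X') (g : Y ⟶ Y') (x : Points X)
    (y : Points Y) : (pair x y).map (f ⊗ₘ g) = pair (x.map f) (y.map g) :=
  lift_map (V := 𝟙_ (Over SpecC)) x y f g

theorem continuous_pair : Continuous fun p : Points X × Points Y => pair p.1 p.2 := by
  refine continuous_iff_continuousAt.2 fun ⟨x, y⟩ => ?_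
  obtain ⟨_, ⟨U, hU, rfl⟩, hxU, -⟩ := X.left.isBasis_affineOpens.exists_subset_of_mem_open
    (Set.mem_univ x.pt) isOpen_univ
  obtain ⟨_, ⟨V, hV, rfl⟩, hyV, -⟩ := Y.left.isBasis_affineOpens.exists_subset_of_mem_open
    (Set.mem_univ y.pt) isOpen_univ
  have H : IsPullback (fst X Y).left (snd X Y).left X.hom Y.hom := .of_hasPullback _ _
  set W : (X ⊗ Y).left.Opens := (fst X Y).left ⁻¹ᵁ U ⊓ (snd X Y).left ⁻¹ᵁ V with hW
  have hUS : U ≤ X.hom ⁻¹ᵁ ⊤ := le_top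
  have hVS : V ≤ Y.hom ⁻¹ᵁ ⊤ := le_top
  have hS : IsAffineOpen (⊤ : SpecC.Opens) := isAffineOpen_top _
  have hWaff : IsAffineOpen W := by
    have : IsAffine _ := hS
    have : IsAffine _ := hU
    have : IsAffine _ := hV
    exact .of_isIso (Scheme.Hom.isPullback_resLE H hVS hUS hW).isoPullback.hom
  have hmem (p : Points X × Points Y) (h1 : p.1.Mem U) (h2 : p.2.Mem V) : (pair p.1 p.2).Mem W := by
    rw [mem_iff] at h1 h2 ⊢
    refine ⟨?_, ?_⟩
    · change (fst X Y).left (pair p.1 p.2).pt ∈ U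
      rwa [← pt_map, pair_map_fst]
    · change (snd X Y).left (pair p.1 p.2).pt ∈ V
      rwa [← pt_map, pair_map_snd]
  have hx : x.Mem U := (mem_iff _ _).2 hxU
  have hy : y.Mem V := (mem_iff _ _).2 hyV
  have hev : ∀ᶠ p : Points X × Points Y in 𝓝 (x, y), p.1.Mem U ∧ p.2.Mem V :=
    ((isOpen_setOf_mem U).prod (isOpen_setOf_mem V)).mem_nhds ⟨hx, hy⟩
  refine continuousAt_of_eval hWaff (hev.mono fun p hp => hmem p hp.1 hp.2) fun s => ?_
  -- Functions on `W` are the pushout of those on `U` and `V`, hence generated as a ring by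
  -- pullbacks from the factors, whose continuity is known.
  have hpo := (isIso_pushoutSection_iff H hVS hUS hW).1
    (isIso_pushoutSection_of_isAffineOpen H hVS hUS hW hS hV hU)
  have hs : s ∈ Subring.closure _ := (closure_range_union_of_isPushout hpo).symm ▸ Subring.mem_top s
  have congr₂ {f : Points X × Points Y → ℂ} (t : Γ((X ⊗ Y).left, W))
      (h : ∀ p : Points X × Points Y, ∀ (h : (pair p.1 p.2).Mem W), p.1.Mem U → p.2.Mem V →
        (pair p.1 p.2).valueHom h t = f p) (hf : ContinuousAt f (x, y)) :
      ContinuousAt (fun p : Points X × Points Y => (pair p.1 p.2).eval W t) (x, y) := by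
    refine hf.congr (hev.mono fun p hp => ?_)
    change f p = (pair p.1 p.2).eval W t
    rw [eval_of_mem (hmem p hp.1 hp.2), ← valueHom_apply, h _ _ hp.1 hp.2]
  induction hs using Subring.closure_induction with
  | mem t ht =>
    rcases ht with ⟨a, rfl⟩ | ⟨b, rfl⟩
    · refine congr₂ _ (f := fun p => p.1.eval U a) (fun p h h1 _ => ?_)
        ((continuousAt_eval hx a).comp (f := Prod.fst) (x := (x, y)) continuousAt_fst)
      rw [valueHom_apply, ← value_map (fst X Y) (pair p.1 p.2) (by rwa [pair_map_fst]),
        ← eval_of_mem, pair_map_fst]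
    · refine congr₂ _ (f := fun p => p.2.eval V b) (fun p h _ h2 => ?_)
        ((continuousAt_eval hy b).comp (f := Prod.snd) (x := (x, y)) continuousAt_snd)
      rw [valueHom_apply, ← value_map (snd X Y) (pair p.1 p.2) (by rwa [pair_map_snd]),
        ← eval_of_mem, pair_map_snd]
  | zero => exact congr₂ _ (f := fun _ => 0) (fun p h _ _ => map_zero _) continuousAt_const
  | one => exact congr₂ _ (f := fun _ => 1) (fun p h _ _ => map_one _) continuousAt_const
  | add a b _ _ ha hb =>
    exact congr₂ _ (fun p h _ _ => by
      rw [map_add, valueHom_apply, valueHom_apply, ← eval_of_mem, ← eval_of_mem]; rfl) (ha.add hb)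
  | neg a _ ha =>
    exact congr₂ _ (fun p h _ _ => by rw [map_neg, valueHom_apply, ← eval_of_mem]; rfl) ha.neg
  | mul a b _ _ ha hb =>
    exact congr₂ _ (fun p h _ _ => by
      rw [map_mul, valueHom_apply, valueHom_apply, ← eval_of_mem, ← eval_of_mem]; rfl) (ha.mul hb)

end Points

namespace ToricVariety

variable {n : ℕ} (X : ToricVariety n)

theorem smul_eq (t : Points (torus n)) (x : Points X.X) :
    X.smul t x = (Points.pair t x).map X.act := rfl

theorem continuous_smul :
    Continuous fun p : Points (torus n) × Points X.X => X.smul p.1 p.2 :=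
  (Points.continuous_map X.act).comp Points.continuous_pair

theorem one_smul (x : Points X.X) : X.smul 1 x = x := by
  let := X.action
  exact @_root_.one_smul (𝟙_ (Over SpecC) ⟶ torus n) (𝟙_ (Over SpecC) ⟶ X.X) _ _ x

theorem mul_smul (s t : Points (torus n)) (x : Points X.X) :
    X.smul (s * t) x = X.smul s (X.smul t x) := by
  let := X.action
  exact SemigroupAction.mul_smul (α := 𝟙_ (Over SpecC) ⟶ torus n) (β := 𝟙_ (Over SpecC) ⟶ X.X)
    s t x

end ToricVariety

theorem ToricHom.map_smul {n : ℕ} {Y X : ToricVariety n} (h : ToricHom Y X)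
    (t : Points (torus n)) (y : Points Y.X) :
    (Y.smul t y).map h.f = X.smul (t.map h.φ) (y.map h.f) := by
  rw [ToricVariety.smul_eq, ← Points.map_comp, h.equivariant, Points.map_comp]
  rw [Points.pair_map_tensorHom]
  rfl

end ProalgebraicToric

end

/-! ### Homomorphisms and complex points of the torus. -/

noncomputable section

namespace ProalgebraicToric

open Topology Filter

/-! ### Homomorphisms of affine monoid schemes -/

section BialgebraHom

variable {R A B : CommRingCat.{0}} [Bialgebra R A] [Bialgebra R B]

/-- The homomorphism of monoid schemes given by a homomorphism of bialgebras. -/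
def specBialgHom (f : A →ₐc[R] B) : (Spec B).asOver (Spec R) ⟶ (Spec A).asOver (Spec R) :=
  ((bialgSpec R).map (.op (CommBialgCat.ofHom f))).hom

instance isMonHom_specBialgHom (f : A →ₐc[R] B) : IsMonHom (specBialgHom f) :=
  ((bialgSpec R).map (.op (CommBialgCat.ofHom f))).isMonHom_hom

theorem specBialgHom_left (f : A →ₐc[R] B) :
    (specBialgHom f).left = Spec.map (CommRingCat.ofHom (f : A →ₐ[R] B).toRingHom) := rfl

/-- `Spec` is fully faithful from commutative bialgebras (reversed) to monoid schemes. -/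
theorem exists_eq_specBialgHom (φ : (Spec B).asOver (Spec R) ⟶ (Spec A).asOver (Spec R))
    [IsMonHom φ] : ∃ f : A →ₐc[R] B, φ = specBialgHom f := by
  let A' : CommBialgCat R := .of R A
  let B' : CommBialgCat R := .of R B
  let φ' : (bialgSpec R).obj (.op B') ⟶ (bialgSpec R).obj (.op A') :=
    @Mon.Hom.mk _ _ _ ((bialgSpec R).obj (.op B')) ((bialgSpec R).obj (.op A')) φ ‹_›
  let f := (bialgSpec.fullyFaithful (R := R)).preimage φ'
  have hf := (bialgSpec.fullyFaithful (R := R)).map_preimage φ'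
  exact ⟨f.unop.hom, congrArg Mon.Hom.hom hf.symm⟩

end BialgebraHom

/-! ### Homomorphisms of tori -/

/-- The character lattice `ℤⁿ`, written multiplicatively. -/
abbrev Lattice (n : ℕ) : Type := Multiplicative (Fin n → ℤ)

variable {n : ℕ}

/-- The homomorphism of tori given by a homomorphism of character lattices. -/
def torusHom (α : Lattice n →* Lattice n) : torus n ⟶ torus n :=
  specBialgHom (R := .of ℂ) (A := .of (MonoidAlgebra ℂ (Lattice n)))
    (B := .of (MonoidAlgebra ℂ (Lattice n))) (MonoidAlgebra.mapDomainBialgHom ℂ α)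

instance (α : Lattice n →* Lattice n) : IsMonHom (torusHom α) :=
  isMonHom_specBialgHom _

/-- The ring homomorphism of coordinate rings given by a homomorphism of lattices. -/
abbrev coordRingHom (α : Lattice n →* Lattice n) :
    MonoidAlgebra ℂ (Lattice n) →+* MonoidAlgebra ℂ (Lattice n) :=
  (MonoidAlgebra.mapDomainBialgHom ℂ α :
    MonoidAlgebra ℂ (Lattice n) →ₐ[ℂ] MonoidAlgebra ℂ (Lattice n)).toRingHom

theorem torusHom_left (α : Lattice n →* Lattice n) :
    (torusHom α).left = Spec.map (CommRingCat.ofHom (coordRingHom α)) :=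
  specBialgHom_left _

theorem torusHom_comp (α β : Lattice n →* Lattice n) :
    torusHom (α.comp β) = torusHom α ≫ torusHom β := by
  have h : CommRingCat.ofHom (coordRingHom (α.comp β)) =
      CommRingCat.ofHom (coordRingHom β) ≫ CommRingCat.ofHom (coordRingHom α) := by
    rw [coordRingHom, MonoidAlgebra.mapDomainBialgHom_comp]
    rfl
  have h' := (congrArg Spec.map h).trans (Spec.map_comp _ _)
  rw [← torusHom_left, ← torusHom_left, ← torusHom_left] at h'
  exact Over.OverMorphism.ext h'

/-- A bialgebra map of `ℂ[ℤⁿ]` preserves grouplike elements, and these are exactly the lattice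
elements. -/
theorem exists_eq_torusHom (φ : torus n ⟶ torus n) [IsMonHom φ] : ∃ α, φ = torusHom α := by
  obtain ⟨f, hf⟩ := exists_eq_specBialgHom (R := .of ℂ) (A := .of (MonoidAlgebra ℂ (Lattice n)))
    (B := .of (MonoidAlgebra ℂ (Lattice n))) φ
  refine ⟨MonoidAlgebra.mapDomainOfBialgHom f, ?_⟩
  rw [torusHom, MonoidAlgebra.mapDomainBialgHom_mapDomainOfBialgHom]
  exact hf

/-! ### Points of the torus -/

/-- `Spec ℂ` as the spectrum of a `ℂ`-algebra, over `Spec ℂ`. -/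
abbrev specBase : Over SpecC :=
  @Scheme.asOver (Spec (.of ℂ)) SpecC (specOverSpec (R := .of ℂ) (A := .of ℂ))

/-- The identification of `Spec ℂ` with the terminal object. -/
def specBaseIso : specBase ≅ 𝟙_ (Over SpecC) :=
  Over.isoMk (Iso.refl (Spec (.of ℂ))) (by
    have h : specBase.hom = 𝟙 (Spec (.of ℂ)) := by
      rw [← Spec.map_id]
      refine congrArg Spec.map ?_
      ext z
      exact congrArg (fun f : ℂ →+* ℂ => f z) (Algebra.algebraMap_self (R := ℂ))
    rw [h]
    exact Category.id_comp _)

/-- Complex points as morphisms from the spectrum of the algebra `ℂ`. -/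
def pointsEquiv (G : Over SpecC) [GrpObj G] : Points G ≃* (specBase ⟶ G) where
  toFun x := specBaseIso.hom ≫ x
  invFun x := specBaseIso.inv ≫ x
  left_inv x := specBaseIso.inv_hom_id_assoc x
  right_inv x := specBaseIso.hom_inv_id_assoc x
  map_mul' x y := MonObj.comp_mul specBaseIso.hom x y

/-- Complex points of the torus are characters of the lattice. -/
def torusEquiv (n : ℕ) : Points (torus n) ≃* (Lattice n →* ℂ) :=
  (pointsEquiv (torus n)).trans
    ((Spec.mapMulEquiv (R := ℂ) (S := MonoidAlgebra ℂ (Lattice n)) (T := ℂ)).symm.trans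
      (MonoidAlgebra.liftMulEquiv ℂ ℂ (Lattice n)).symm)

/-- The morphism `Spec ℂ ⟶ Spec ℂ[ℤⁿ]` given by a character. -/
def specOfChar (χ : Lattice n →* ℂ) : SpecC ⟶ Spec (.of (MonoidAlgebra ℂ (Lattice n))) :=
  Spec.map (CommRingCat.ofHom (MonoidAlgebra.lift ℂ ℂ (Lattice n) χ).toRingHom)

theorem specOfChar_injective : Function.Injective (specOfChar (n := n)) := by
  intro χ ψ h
  have h1 := congrArg CommRingCat.Hom.hom (Spec.map_injective h)
  have h2 : MonoidAlgebra.lift ℂ ℂ (Lattice n) χ = MonoidAlgebra.lift ℂ ℂ (Lattice n) ψ :=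
    AlgHom.coe_ringHom_injective h1
  exact (MonoidAlgebra.lift ℂ ℂ (Lattice n)).injective h2

theorem torus_hom_eq (t : Points (torus n)) : t.hom = specOfChar (torusEquiv n t) := by
  have h : pointsEquiv (torus n) t = Spec.mapMulEquiv
      (MonoidAlgebra.liftMulEquiv ℂ ℂ (Lattice n) (torusEquiv n t)) := by
    simp [torusEquiv]
  have h' := congrArg Over.Hom.left h
  exact (Category.id_comp _).symm.trans h'

theorem torusEquiv_eq_iff (t : Points (torus n)) (χ : Lattice n →* ℂ) :
    torusEquiv n t = χ ↔ t.hom = specOfChar χ :=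
  ⟨fun h => h ▸ torus_hom_eq t, fun h => specOfChar_injective ((torus_hom_eq t).symm.trans h)⟩

@[simp]
theorem torusEquiv_torusPoint (u : Fin n → ℂˣ) : torusEquiv n (torusPoint u) = latticeChar u :=
  (torusEquiv_eq_iff _ _).2 rfl

theorem torusEquiv_map (α : Lattice n →* Lattice n) (t : Points (torus n)) :
    torusEquiv n (t.map (torusHom α)) = (torusEquiv n t).comp α := by
  rw [torusEquiv_eq_iff, Points.hom_map, torusHom_left, torus_hom_eq]
  have h : (MonoidAlgebra.lift ℂ ℂ (Lattice n) ((torusEquiv n t).comp α)).toRingHom =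
      (MonoidAlgebra.lift ℂ ℂ (Lattice n) (torusEquiv n t)).toRingHom.comp (coordRingHom α) := by
    refine MonoidAlgebra.ringHom_ext (fun r => ?_) fun a => ?_ <;> simp [coordRingHom]
  rw [specOfChar, specOfChar, h, CommRingCat.ofHom_comp, Spec.map_comp]
  rfl

/-- The coordinates of a point of the torus. -/
def torusCoord (t : Points (torus n)) (i : Fin n) : ℂˣ :=
  (torusEquiv n t).toHomUnits (.ofAdd (Pi.single i 1))

theorem latticeChar_injective : Function.Injective (latticeChar (n := n)) := by
  intro u v h
  ext i
  have := DFunLike.congr_fun h (.ofAdd (Pi.single i 1))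
  simpa [latticeChar, Pi.single_apply, Finset.prod_ite_eq, apply_ite] using this

theorem latticeChar_torusCoord (t : Points (torus n)) :
    latticeChar (torusCoord t) = torusEquiv n t := by
  refine MonoidHom.ext fun m => ?_
  have hm : ∏ i, (.ofAdd (Pi.single i 1) : Lattice n) ^ (m.toAdd i) = m := by
    apply Multiplicative.toAdd.injective
    ext j
    simp [Pi.single_apply]
  have h : ∏ i, torusCoord t i ^ (m.toAdd i) = (torusEquiv n t).toHomUnits m := by
    conv_rhs => rw [← hm]
    simp only [map_prod, map_zpow, torusCoord]
  exact congrArg Units.val h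

@[simp]
theorem torusPoint_torusCoord (t : Points (torus n)) : torusPoint (torusCoord t) = t :=
  (torusEquiv n).injective (by rw [torusEquiv_torusPoint, latticeChar_torusCoord])

@[simp]
theorem torusCoord_torusPoint (u : Fin n → ℂˣ) : torusCoord (torusPoint u) = u :=
  latticeChar_injective (by rw [latticeChar_torusCoord, torusEquiv_torusPoint])

theorem torusPoint_mul (u v : Fin n → ℂˣ) : torusPoint (u * v) = torusPoint u * torusPoint v := by
  apply (torusEquiv n).injective
  rw [map_mul, torusEquiv_torusPoint, torusEquiv_torusPoint, torusEquiv_torusPoint]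
  ext m
  simp [latticeChar, mul_zpow, Finset.prod_mul_distrib]

/-- Complex points of the torus, as a group. -/
def torusPointEquiv (n : ℕ) : (Fin n → ℂˣ) ≃* Points (torus n) where
  toFun := torusPoint
  invFun := torusCoord
  left_inv := torusCoord_torusPoint
  right_inv := torusPoint_torusCoord
  map_mul' := torusPoint_mul

/-! ### The topology of the points of the torus -/

/-- The regular function on the torus given by an element of the coordinate ring. -/
def torusFun (r : MonoidAlgebra ℂ (Lattice n)) : Γ((torus n).left, ⊤) :=
  (Scheme.ΓSpecIso (.of (MonoidAlgebra ℂ (Lattice n)))).inv r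

theorem torusFun_surjective : Function.Surjective (torusFun (n := n)) := fun s =>
  ⟨(Scheme.ΓSpecIso (.of (MonoidAlgebra ℂ (Lattice n)))).hom s,
    (Scheme.ΓSpecIso (.of (MonoidAlgebra ℂ (Lattice n)))).hom_inv_id_apply s⟩

theorem mem_top (t : Points (torus n)) : t.Mem ⊤ := (Points.mem_iff _ _).2 trivial

theorem eval_torusFun (t : Points (torus n)) (r : MonoidAlgebra ℂ (Lattice n)) :
    t.eval ⊤ (torusFun r) = MonoidAlgebra.lift ℂ ℂ (Lattice n) (torusEquiv n t) r := by
  have key (f : MonoidAlgebra ℂ (Lattice n) →+* ℂ)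
      (g : SpecC ⟶ Spec (.of (MonoidAlgebra ℂ (Lattice n)))) (hg : g = Spec.map (CommRingCat.ofHom f))
      (h : ⊤ ≤ g ⁻¹ᵁ ⊤) :
      (Scheme.ΓSpecIso (.of ℂ)).hom (g.appLE ⊤ ⊤ h ((Scheme.ΓSpecIso _).inv r)) = f r := by
    subst hg
    have h2 : (Scheme.ΓSpecIso _).inv ≫ (Spec.map (CommRingCat.ofHom f)).appLE ⊤ ⊤ h =
        CommRingCat.ofHom f ≫ (Scheme.ΓSpecIso (.of ℂ)).inv := by
      rw [Scheme.ΓSpecIso_inv_naturality (CommRingCat.ofHom f)]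
      congr 1
    have h3 := congrArg (fun k => (Scheme.ΓSpecIso (.of ℂ)).hom (k.hom r)) h2
    exact h3.trans ((Scheme.ΓSpecIso (.of ℂ)).inv_hom_id_apply _)
  rw [Points.eval_of_mem (mem_top t)]
  exact key _ t.hom (torus_hom_eq t) (mem_top t)

theorem continuous_torusPoint : Continuous (torusPoint (n := n)) := by
  have : IsAffine (torus n).left := inferInstanceAs (IsAffine (Spec _))
  refine Points.continuous_of_eval_top (X := torus n) (g := torusPoint) fun s => ?_
  obtain ⟨r, rfl⟩ := torusFun_surjective s
  simp only [eval_torusFun, torusEquiv_torusPoint]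
  -- Regular functions are linear combinations of characters, which are Laurent monomials in the
  -- coordinates.
  induction r using MonoidAlgebra.induction_linear with
  | zero => simpa using (continuous_const : Continuous fun _ : Fin n → ℂˣ => (0 : ℂ))
  | add f g hf hg =>
    simp only [map_add]
    exact hf.add hg
  | single m c =>
    simp only [MonoidAlgebra.lift_single, latticeChar, MonoidHom.coe_mk, OneHom.coe_mk]
    refine Continuous.const_smul (Units.continuous_val.comp ?_) c
    exact continuous_finsetProd _ fun i _ => (continuous_apply i).zpow _

theorem continuous_torusChar (m : Lattice n) :
    Continuous fun t : Points (torus n) => torusEquiv n t m := by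
  refine continuous_iff_continuousAt.2 fun t => ?_
  convert Points.continuousAt_eval (mem_top t) (torusFun (.single m 1)) using 2 with u
  simp [eval_torusFun]

theorem continuous_torusCoord : Continuous (torusCoord (n := n)) := by
  -- The topology of `ℂˣ` also sees the inverse, which is the value of the inverse character.
  refine continuous_pi fun i => Units.continuous_iff.2 ⟨continuous_torusChar _, ?_⟩
  convert continuous_torusChar (n := n) (.ofAdd (Pi.single i 1))⁻¹ using 2 with t
  simp [torusCoord, ← map_inv]

/-! ### Maps induced by homomorphisms of tori -/

theorem Points.map_mul {G H : Over SpecC} [GrpObj G] [GrpObj H] (φ : G ⟶ H) [IsMonHom φ]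
    (s t : Points G) : (s * t).map φ = s.map φ * t.map φ :=
  MonObj.mul_comp (X := 𝟙_ (Over SpecC)) s t φ

theorem Points.map_one {G H : Over SpecC} [GrpObj G] [GrpObj H] (φ : G ⟶ H) [IsMonHom φ] :
    (1 : Points G).map φ = 1 :=
  MonObj.one_comp (X := 𝟙_ (Over SpecC)) φ

theorem map_torusHom_pow (N : ℕ) (t : Points (torus n)) :
    t.map (torusHom (powMonoidHom N)) = t ^ N := by
  apply (torusEquiv n).injective
  rw [torusEquiv_map, map_pow]
  ext m
  simp

end ProalgebraicToric

end

/-! ### Isogenies of tori and their lattice maps. -/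

noncomputable section

namespace ProalgebraicToric

variable {n : ℕ}

/-! ### Finite homomorphisms of tori -/

theorem isFinite_torusHom_pow {N : ℕ} (hN : 0 < N) :
    IsFinite (torusHom (n := n) (powMonoidHom N)).left := by
  rw [torusHom_left]
  refine (IsFinite.SpecMap_iff _).2 ?_
  rw [CommRingCat.hom_ofHom]
  refine RingHom.IsIntegral.to_finite ?_ ?_
  · intro r
    induction r using MonoidAlgebra.induction_linear with
    | zero => exact RingHom.isIntegralElem_zero _
    | add f g hf hg => exact hf.add _ hg
    | single m c =>
      have h1 : (coordRingHom (powMonoidHom N)).IsIntegralElem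
          (MonoidAlgebra.single m 1 : MonoidAlgebra ℂ (Lattice n)) := by
        -- The coefficients are mapped by the ring homomorphism first, so this polynomial becomes `X
        -- ^ N - m ^ N`, with root `m`.
        refine ⟨Polynomial.X ^ N - Polynomial.C (MonoidAlgebra.single m 1),
          Polynomial.monic_X_pow_sub_C _ hN.ne', ?_⟩
        simp [MonoidAlgebra.single_pow, coordRingHom]
      have h2 : (coordRingHom (powMonoidHom N)).IsIntegralElem
          (MonoidAlgebra.single 1 c : MonoidAlgebra ℂ (Lattice n)) := by
        have := (coordRingHom (n := n) (powMonoidHom N)).isIntegralElem_map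
          (x := MonoidAlgebra.single 1 c)
        simpa [coordRingHom] using this
      have := h1.mul _ h2
      simpa [MonoidAlgebra.single_mul_single] using this
  · have h : Algebra.FiniteType ℂ (MonoidAlgebra ℂ (Lattice n)) := inferInstance
    have h1 : (algebraMap ℂ (MonoidAlgebra ℂ (Lattice n))).FiniteType :=
      RingHom.finiteType_algebraMap.2 h
    have h2 : (coordRingHom (n := n) (powMonoidHom N)).comp (algebraMap ℂ _) = algebraMap ℂ _ :=
      AlgHom.comp_algebraMap ((MonoidAlgebra.mapDomainBialgHom ℂ (powMonoidHom N) :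
        MonoidAlgebra ℂ (Lattice n) →ₐc[ℂ] MonoidAlgebra ℂ (Lattice n)) :
        MonoidAlgebra ℂ (Lattice n) →ₐ[ℂ] MonoidAlgebra ℂ (Lattice n))
    exact RingHom.FiniteType.of_comp_finiteType (f := algebraMap ℂ (MonoidAlgebra ℂ (Lattice n)))
      (g := coordRingHom (powMonoidHom N)) (h2.symm ▸ h1)

/-- In a monic equation of degree `d` for the monomial `m`, look at the coefficient of `m ^ d`. The
leading term contributes `1`, and the term of degree `i` contributes only if `m ^ (d - i)` lies in
the range of `α`, which supports the image of the coefficient ring. So some such power does. -/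
theorem exists_pow_mem_range_of_isIntegral {α : Lattice n →* Lattice n}
    (h : (coordRingHom α).IsIntegral) (m : Lattice n) : ∃ k : ℕ, 0 < k ∧ m ^ k ∈ α.range := by
  obtain ⟨p, hp, hm⟩ := h (.single m 1)
  by_contra! hk
  have h1 : (Polynomial.eval₂ (coordRingHom α) (.single m 1) p).coeff (m ^ p.natDegree) = 1 := by
    rw [Polynomial.eval₂_eq_sum_range]
    simp only [MonoidAlgebra.single_pow, one_pow]
    rw [Finset.sum_range_succ, hp.coeff_natDegree, map_one, one_mul, MonoidAlgebra.coeff_add,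
      Finsupp.add_apply, MonoidAlgebra.coeff_sum, Finsupp.finsetSum_apply,
      Finset.sum_eq_zero, zero_add]
    · simp
    · intro i hi
      have hi' := Finset.mem_range.1 hi
      rw [MonoidAlgebra.coeff_mul_single_apply, mul_one]
      refine Finsupp.mapDomain_of_notMem_range _ _ ?_
      rw [← pow_sub _ hi'.le]
      exact hk _ (Nat.sub_pos_of_lt hi')
  rw [hm] at h1
  simp at h1

/-- A homomorphism of lattices with torsion cokernel divides multiplication by some `N`. -/
theorem exists_comp_eq_pow {α : Lattice n →* Lattice n}
    (h : ∀ m, ∃ k : ℕ, 0 < k ∧ m ^ k ∈ α.range) :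
    ∃ (N : ℕ) (β : Lattice n →* Lattice n), 0 < N ∧ α.comp β = powMonoidHom N ∧
      β.comp α = powMonoidHom N := by
  let a : (Fin n → ℤ) →ₗ[ℤ] (Fin n → ℤ) := (AddMonoidHom.toMultiplicative.symm α).toIntLinearMap
  choose k hk hkr using fun i : Fin n => h (.ofAdd (Pi.single i 1))
  choose c hc using hkr
  -- Since `a (c i) = k i • e i`, sending `e i` to `(N / k i) • c i` is a right inverse of `a` up to
  -- `N`, for any common multiple `N` of the `k i`.
  let N : ℕ := ∏ i, k i
  have hN : 0 < N := Finset.prod_pos fun i _ => hk i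
  let b : (Fin n → ℤ) →ₗ[ℤ] (Fin n → ℤ) :=
    (Pi.basisFun ℤ (Fin n)).constr ℤ fun i => (N / k i) • (c i).toAdd
  have hab : a ∘ₗ b = (N : ℤ) • LinearMap.id := by
    refine (Pi.basisFun ℤ (Fin n)).ext fun i => ?_
    have h1 : a (c i).toAdd = k i • (Pi.single i 1 : Fin n → ℤ) := hc i
    rw [LinearMap.comp_apply, Module.Basis.constr_basis, map_nsmul, h1, smul_smul,
      Nat.div_mul_cancel (Finset.dvd_prod_of_mem k (Finset.mem_univ i)), LinearMap.smul_apply,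
      LinearMap.id_apply, natCast_zsmul, Pi.basisFun_apply]
  have hab' (v : Fin n → ℤ) : a (b v) = N • v := by
    rw [← LinearMap.comp_apply, hab, LinearMap.smul_apply, LinearMap.id_apply, natCast_zsmul]
  -- As `det a * det b = N ^ n ≠ 0`, `a` is injective; cancelling it in `a b a = N a` gives `b a =
  -- N`.
  have hinj : Function.Injective a := by
    have hdet : LinearMap.det a * LinearMap.det b = (N : ℤ) ^ n := by
      rw [← LinearMap.det_comp, hab, LinearMap.det_smul, LinearMap.det_id, mul_one]
      simp
    have hne : LinearMap.det a ≠ 0 := by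
      intro h0
      rw [h0, zero_mul] at hdet
      exact pow_ne_zero n (by exact_mod_cast hN.ne') hdet.symm
    refine (injective_iff_map_eq_zero a).2 fun v hv => ?_
    rw [← LinearMap.det_toMatrix'] at hne
    refine Matrix.eq_zero_of_mulVec_eq_zero hne ?_
    rwa [LinearMap.toMatrix'_mulVec]
  have hba (v : Fin n → ℤ) : b (a v) = N • v := hinj (by rw [hab', map_nsmul])
  exact ⟨N, AddMonoidHom.toMultiplicative b.toAddMonoidHom, hN,
    MonoidHom.ext fun m => hab' m.toAdd, MonoidHom.ext fun m => hba m.toAdd⟩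

end ProalgebraicToric

end

/-! ### Normal rings and schemes, and finite integral closures. -/

noncomputable section

namespace ProalgebraicToric

/-! ### Normality of the torus -/

theorem isIntegrallyClosed_laurent (R : Type*) [CommRing R] [IsDomain R] [IsIntegrallyClosed R] :
    IsDomain (LaurentPolynomial R) ∧ IsIntegrallyClosed (LaurentPolynomial R) := by
  have hle : Submonoid.powers (Polynomial.X : Polynomial R) ≤ nonZeroDivisors _ :=
    powers_le_nonZeroDivisors_of_noZeroDivisors Polynomial.X_ne_zero
  exact ⟨IsLocalization.isDomain_of_le_nonZeroDivisors (S := LaurentPolynomial R) hle,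
    isIntegrallyClosed_of_isLocalization (R := Polynomial R) _ _ hle⟩

/-- The group ring of `ℤⁿ⁺¹` is the Laurent polynomial ring over that of `ℤⁿ`, a localization of a
polynomial ring. -/
theorem isIntegrallyClosed_monoidAlgebra_lattice (n : ℕ) :
    ∀ (R : Type) [CommRing R] [IsDomain R] [IsIntegrallyClosed R],
    IsDomain (MonoidAlgebra R (Lattice n)) ∧ IsIntegrallyClosed (MonoidAlgebra R (Lattice n)) := by
  induction n with
  | zero =>
    intro R _ _ _
    let e : R ≃+* MonoidAlgebra R (Lattice 0) :=
      RingEquiv.ofBijective (algebraMap R (MonoidAlgebra R (Lattice 0))) (by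
        refine ⟨FaithfulSMul.algebraMap_injective _ _, fun x => ⟨x.coeff 1, ?_⟩⟩
        refine MonoidAlgebra.ext (Finsupp.ext fun m => ?_)
        rw [Subsingleton.elim m 1]
        simp [MonoidAlgebra.coe_algebraMap])
    exact ⟨e.symm.toMulEquiv.isDomain _, IsIntegrallyClosed.of_equiv e⟩
  | succ n ih =>
    intro R _ _ _
    obtain ⟨h1, h2⟩ := ih R
    obtain ⟨h3, h4⟩ := isIntegrallyClosed_laurent (MonoidAlgebra R (Lattice n))
    let e₀ : Lattice (n + 1) ≃* Multiplicative ℤ × Lattice n :=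
      (AddEquiv.toMultiplicative (Fin.consLinearEquiv ℤ fun _ => ℤ).symm.toAddEquiv).trans
        (MulEquiv.prodMultiplicative _ _)
    let e : LaurentPolynomial (MonoidAlgebra R (Lattice n)) ≃+* MonoidAlgebra R (Lattice (n + 1)) :=
      (AddMonoidAlgebra.toMultiplicative _ _).trans
        (MonoidAlgebra.curryRingEquiv.symm.trans (MonoidAlgebra.mapDomainRingEquiv R e₀.symm))
    exact ⟨e.symm.toMulEquiv.isDomain _, IsIntegrallyClosed.of_equiv e⟩

/-! ### Finiteness of integral closures -/

/-- `B'` is finite over `A' = A[1/h]`, so its fraction field `L` is finite over that of `A`, and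
separable in characteristic zero. Thus the integral closure of `A` in `L` is a finite, hence
Noetherian, `A`-module; it contains the integral closure of `A` in `B`. -/
theorem finite_integralClosure_of_localization {A B A' B' : Type*} [CommRing A] [CommRing B]
    [CommRing A'] [CommRing B'] [IsDomain A] [IsDomain B'] [IsIntegrallyClosed A]
    [IsNoetherianRing A] [CharZero A] [Algebra A B] [Algebra A A'] [Algebra A B'] [Algebra B B']
    [Algebra A' B'] [IsScalarTower A B B'] [IsScalarTower A A' B'] {h : A} (hh : h ≠ 0)
    [IsLocalization.Away h A'] [Module.Finite A' B']
    (hB : Function.Injective (algebraMap B B')) (hA : Function.Injective (algebraMap A' B')) :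
    Module.Finite A (integralClosure A B) := by
  have hle : Submonoid.powers h ≤ nonZeroDivisors A :=
    powers_le_nonZeroDivisors_of_noZeroDivisors hh
  have : IsDomain A' := IsLocalization.isDomain_of_le_nonZeroDivisors (S := A') hle
  have hAA' : Function.Injective (algebraMap A A') := IsLocalization.injective A' hle
  have : FaithfulSMul A' B' := (faithfulSMul_iff_algebraMap_injective A' B').2 hA
  have : Module.IsTorsionFree A' B' := inferInstance
  let K := FractionRing A'
  let L := FractionRing B'
  let : Algebra K L := FractionRing.liftAlgebra A' L
  have : FiniteDimensional K L := inferInstance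
  have : IsFractionRing A K := by
    have := IsLocalization.localization_localization_isLocalization_of_has_all_units
      (Submonoid.powers h) (nonZeroDivisors A') K fun x hx => hx.mem_nonZeroDivisors
    convert this
    ext x
    simp [map_eq_zero_iff _ hAA']
  have : CharZero K := charZero_of_injective_algebraMap (IsFractionRing.injective A K)
  have hfin : Module.Finite A (integralClosure A L) := IsIntegralClosure.finite A K L _
  have hnoeth : IsNoetherian A (integralClosure A L) := isNoetherian_of_isNoetherianRing_of_finite _ _
  let f : B →ₐ[A] L := IsScalarTower.toAlgHom A B L
  have hf : Function.Injective f := by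
    change Function.Injective (algebraMap B L)
    rw [IsScalarTower.algebraMap_eq B B' L]
    exact (IsFractionRing.injective B' L).comp hB
  exact Module.Finite.of_injective f.mapIntegralClosure.toLinearMap fun x y hxy =>
    Subtype.ext (hf (congrArg Subtype.val hxy))

/-! ### Normal schemes -/

theorem isIntegrallyClosed_sections {X : Scheme.{0}} [IsIntegral X]
    (h : ∀ x : X, IsIntegrallyClosed (X.presheaf.stalk x)) {U : X.Opens} [Nonempty U]
    (hU : IsAffineOpen U) : IsIntegrallyClosed Γ(X, U) := by
  refine IsIntegrallyClosed.of_localization_maximal fun p _ hp => ?_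
  let y : PrimeSpectrum Γ(X, U) := ⟨p, hp.isPrime⟩
  have hy : hU.fromSpec y ∈ U := hU.range_fromSpec.le ⟨y, rfl⟩
  let := TopCat.Presheaf.algebra_section_stalk X.presheaf ⟨hU.fromSpec y, hy⟩
  have h1 : IsLocalization.AtPrime (X.presheaf.stalk (hU.fromSpec y)) y.asIdeal :=
    hU.isLocalization_stalk' y hy
  exact (h (hU.fromSpec y)).of_equiv
    (IsLocalization.algEquiv y.asIdeal.primeCompl (X.presheaf.stalk (hU.fromSpec y))
      (Localization.AtPrime y.asIdeal)).toRingEquiv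

theorem isIntegrallyClosed_stalk {X : Scheme.{0}} [IsIntegral X] {U : X.Opens}
    (hU : IsAffineOpen U) [IsIntegrallyClosed Γ(X, U)] (x : U) :
    IsIntegrallyClosed (X.presheaf.stalk x.1) := by
  have : Nonempty U := ⟨x⟩
  have := hU.isLocalization_stalk x
  exact isIntegrallyClosed_of_isLocalization (R := Γ(X, U)) _ (hU.primeIdealOf x).asIdeal.primeCompl
    (Ideal.primeCompl_le_nonZeroDivisors _)

end ProalgebraicToric

end

/-! ### Smoothness of the torus and smooth base change of normalizations. -/

noncomputable section

namespace ProalgebraicToric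

/-! ### Smoothness of the torus -/

variable {n : ℕ}

/-- Monoid homomorphisms out of the lattice `ℤⁿ` lift along a map that reflects units. -/
theorem exists_lattice_lift {A B : Type*} [CommMonoid A] [CommMonoid B] (p : A →* B)
    (hp : Function.Surjective p) (hu : ∀ a, IsUnit (p a) → IsUnit a) (χ : Lattice n →* B) :
    ∃ ψ : Lattice n →* A, p.comp ψ = χ := by
  have h : ∀ i, ∃ u : Aˣ, p u = χ (Multiplicative.ofAdd (Pi.single i 1)) := fun i => by
    obtain ⟨a, ha⟩ := hp (χ (Multiplicative.ofAdd (Pi.single i 1)))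
    have : IsUnit a := hu a (ha ▸ (Group.isUnit _).map χ)
    exact ⟨this.unit, ha⟩
  choose u h using h
  let ψ : Lattice n →* Aˣ :=
    { toFun m := ∏ i, u i ^ (m.toAdd i)
      map_one' := by simp
      map_mul' a b := by simp [zpow_add, Finset.prod_mul_distrib] }
  refine ⟨(Units.coeHom A).comp ψ, MonoidHom.ext fun m => ?_⟩
  have hm : ∏ i, (.ofAdd (Pi.single i 1) : Lattice n) ^ (m.toAdd i) = m := by
    apply Multiplicative.toAdd.injective
    ext j
    simp [Pi.single_apply]
  have e : Units.map p (ψ m) = χ.toHomUnits m := by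
    conv_rhs => rw [← hm]
    simp only [map_prod, map_zpow, ψ, MonoidHom.coe_mk, OneHom.coe_mk]
    exact Finset.prod_congr rfl fun i _ => congrArg (· ^ _) (Units.ext (h i))
  exact congrArg Units.val e

/-- Lifting an algebra map out of `R[ℤⁿ]` along a square-zero quotient is lifting a character, and
units lift along nilpotent ideals. -/
theorem formallySmooth_monoidAlgebra_lattice (R : Type) [CommRing R] :
    Algebra.FormallySmooth R (MonoidAlgebra R (Lattice n)) := by
  rw [Algebra.FormallySmooth.iff_comp_surjective]
  intro B _ _ I hI g
  obtain ⟨ψ, hψ⟩ := exists_lattice_lift (Ideal.Quotient.mkₐ R I : B →* B ⧸ I)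
    Ideal.Quotient.mk_surjective
    (fun a ha => (IsNilpotent.isUnit_quotient_mk_iff ⟨2, hI⟩).mp ha)
    ((MonoidAlgebra.lift R _ _).symm g)
  refine ⟨MonoidAlgebra.lift R _ _ ψ, ?_⟩
  apply (MonoidAlgebra.lift R _ _).symm.injective
  rw [← hψ]
  ext m
  simp

theorem smooth_torus (n : ℕ) : Smooth (torus n).hom := by
  have h1 := formallySmooth_monoidAlgebra_lattice (n := n) ℂ
  have h2 : Algebra.FinitePresentation ℂ (MonoidAlgebra ℂ (Lattice n)) :=
    Algebra.FinitePresentation.of_finiteType.mp inferInstance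
  have : (algebraMap ℂ (MonoidAlgebra ℂ (Lattice n))).Smooth := by
    rw [RingHom.smooth_algebraMap]
    exact { }
  change Smooth (Spec.map _)
  rw [HasRingHomProperty.Spec_iff (P := @Smooth)]
  exact this

/-! ### Morphisms out of relative normalizations -/

section Normalization

open Limits

/-- The universal property of the relative normalization after a smooth base change. -/
theorem exists_desc_of_smooth {T S T' Y' S' V W : Scheme.{0}} {f : T ⟶ S} [QuasiCompact f]
    [QuasiSeparated f] {p : S' ⟶ S} [Smooth p] {a : T' ⟶ T} {f' : T' ⟶ S'}
    (hT : IsPullback a f' f p) {b : Y' ⟶ f.normalization} {q' : Y' ⟶ S'}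
    (hY : IsPullback b q' f.fromNormalization p) {j' : T' ⟶ Y'} (hjb : j' ≫ b = a ≫ f.toNormalization)
    (hjq : j' ≫ q' = f') {r : W ⟶ V} [IsIntegralHom r] {h : T' ⟶ W} {g : S' ⟶ V}
    (w : h ≫ r = f' ≫ g) : ∃ l : Y' ⟶ W, j' ≫ l = h ∧ l ≫ r = q' ≫ g := by
  let e := hT.isoPullback
  let F := pullback.snd f p
  -- Replacing `W` by its base change to `S'` gives an integral scheme morphism to `S'`, as the
  -- universal property of the normalization over `S'` requires.
  let H : pullback f p ⟶ pullback r g := pullback.lift (e.inv ≫ h) F (by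
    simp [e, F, w])
  have hF : F = H ≫ pullback.snd r g := (pullback.lift_snd _ _ _).symm
  let d := F.normalizationDesc H (pullback.snd r g) hF
  -- Smoothness of `p` makes `normalizationPullback` an isomorphism, so `Y'` is itself a
  -- normalization of `S'`.
  let l : Y' ⟶ W := hY.isoPullback.hom ≫ inv (f.normalizationPullback p) ≫ d ≫ pullback.fst r g
  have key : j' ≫ hY.isoPullback.hom =
      e.hom ≫ F.toNormalization ≫ f.normalizationPullback p := by
    apply pullback.hom_ext
    · simp [F, e, hjb]
    · simp [F, e, hjq]
  refine ⟨l, ?_, ?_⟩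
  · simp only [l]
    rw [reassoc_of% key, IsIso.hom_inv_id_assoc]
    simp only [d]
    rw [Scheme.Hom.toNormalization_normalizationDesc_assoc]
    rw [show H ≫ pullback.fst r g = e.inv ≫ h from pullback.lift_fst _ _ _, Iso.hom_inv_id_assoc]
  · simp only [l, Category.assoc]
    rw [pullback.condition, reassoc_of% (F.normalizationDesc_comp H (pullback.snd r g) hF)]
    rw [← f.normalizationPullback_snd p, Category.assoc, IsIso.inv_hom_id_assoc]
    simp

/-- Morphisms of schemes over `S` into a separated scheme agree if they agree after restriction along a
scheme-theoretically dominant morphism. -/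
theorem ext_of_isSchemeTheoreticallyDominant {X Y S W : Scheme.{0}} {f g : X ⟶ Y} (s : Y ⟶ S)
    [IsSeparated s] (h : f ≫ s = g ≫ s) (i : W ⟶ X) [IsSchemeTheoreticallyDominant i]
    (hi : i ≫ f = i ≫ g) : f = g := by
  -- The equalizer of `f` and `g`, closed because `s` is separated. As `i` factors through it and
  -- has zero kernel, it is all of `X`.
  let c := pullback.fst (pullback.lift f g h) (pullback.diagonal s)
  let k : W ⟶ pullback (pullback.lift f g h) (pullback.diagonal s) :=
    pullback.lift i (i ≫ f) (by
      apply pullback.hom_ext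
      · simp only [Category.assoc, pullback.lift_fst, pullback.diagonal_fst, Category.comp_id]
      · simp only [Category.assoc, pullback.lift_snd, pullback.diagonal_snd, Category.comp_id, hi])
  have hk : k ≫ c = i := pullback.lift_fst _ _ _
  have hc : IsClosedImmersion c := inferInstance
  have : IsIso c := by
    rw [IsClosedImmersion.isIso_iff_ker_eq_bot, ← le_bot_iff, ← i.ker_eq_bot, ← hk]
    exact k.le_ker_comp c
  have e : c ≫ pullback.lift f g h = pullback.snd _ _ ≫ pullback.diagonal s := pullback.condition
  rw [← cancel_epi c]
  have e1 := congr($e ≫ pullback.fst s s)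
  have e2 := congr($e ≫ pullback.snd s s)
  simp only [Category.assoc, pullback.lift_fst, pullback.lift_snd, pullback.diagonal_fst,
    pullback.diagonal_snd] at e1 e2
  rw [e1, e2]

end Normalization

end ProalgebraicToric

end

/-! ### The torus action on the normalization of a toric variety. -/

noncomputable section

namespace ProalgebraicToric

/-! ### Relative normalizations over `ℂ` -/

section

open Limits

theorem isPullback_whiskerLeft (G : Over SpecC) {T S : Over SpecC} (f : T ⟶ S) :
    IsPullback (snd G T) (G ◁ f) f (snd G S) := by
  refine ⟨⟨by simp⟩, ⟨PullbackCone.IsLimit.mk _ (fun s => lift (s.snd ≫ fst G S) s.fst) ?_ ?_ ?_⟩⟩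
  · intro s; simp
  · intro s
    apply CartesianMonoidalCategory.hom_ext
    · simp
    · simp [s.condition]
  · intro s m h1 h2
    apply CartesianMonoidalCategory.hom_ext
    · simp [← h2]
    · simp [← h1]

theorem isPullback_whiskerLeft_left (G : Over SpecC) {T S : Over SpecC} (f : T ⟶ S) :
    IsPullback (snd G T).left (G ◁ f).left f.left (snd G S).left :=
  (isPullback_whiskerLeft G f).map (Over.forget SpecC)

theorem isPullback_tensor_left (G S : Over SpecC) :
    IsPullback (fst G S).left (snd G S).left G.hom S.hom :=
  IsPullback.of_hasPullback _ _

theorem smooth_snd_left (G S : Over SpecC) [Smooth G.hom] : Smooth (snd G S).left :=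
  MorphismProperty.of_isPullback (isPullback_tensor_left G S) ‹_›

theorem smooth_tensor (G S : Over SpecC) [Smooth G.hom] [Smooth S.hom] : Smooth (G ⊗ S).hom := by
  have := smooth_snd_left G S
  rw [← Over.w (snd G S)]
  infer_instance

variable {T S : Over SpecC} (f : T ⟶ S) [QuasiCompact f.left] [QuasiSeparated f.left]

/-- The relative normalization of a morphism of `ℂ`-schemes. -/
def normalization : Over SpecC := Over.mk (f.left.fromNormalization ≫ S.hom)

/-- The canonical morphism to the relative normalization. -/
def toNormalization : T ⟶ normalization f := Over.homMk f.left.toNormalization (by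
  change f.left.toNormalization ≫ f.left.fromNormalization ≫ S.hom = _
  rw [Scheme.Hom.toNormalization_fromNormalization_assoc, Over.w])

/-- The canonical integral morphism from the relative normalization. -/
def fromNormalization : normalization f ⟶ S := Over.homMk f.left.fromNormalization rfl

@[simp]
theorem toNormalization_fromNormalization : toNormalization f ≫ fromNormalization f = f :=
  Over.OverMorphism.ext f.left.toNormalization_fromNormalization

variable {f}

/-- The projection `G ⊗ S ⟶ S` is smooth, so `G ⊗ normalization f` has the universal property of the
normalization of `G ◁ f`. This is what extends the torus action. -/
theorem exists_tensor_normalization_desc {G V W : Over SpecC} [Smooth G.hom] {r : W ⟶ V}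
    [IsIntegralHom r.left] {h : G ⊗ T ⟶ W} {g : G ⊗ S ⟶ V} (w : h ≫ r = (G ◁ f) ≫ g) :
    ∃ l : G ⊗ normalization f ⟶ W, (G ◁ toNormalization f) ≫ l = h ∧
      l ≫ r = (G ◁ fromNormalization f) ≫ g := by
  have := smooth_snd_left G S
  obtain ⟨l, h1, h2⟩ := exists_desc_of_smooth (isPullback_whiskerLeft_left G f)
    (isPullback_whiskerLeft_left G (fromNormalization f)) (j' := (G ◁ toNormalization f).left)
    (isPullback_whiskerLeft_left G (toNormalization f)).w.symm
    (by rw [← Over.comp_left, ← MonoidalCategory.whiskerLeft_comp, toNormalization_fromNormalization])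
    (r := r.left) (h := h.left) (g := g.left) (by rw [← Over.comp_left, w, Over.comp_left])
  refine ⟨Over.homMk l ?_, Over.OverMorphism.ext h1, Over.OverMorphism.ext h2⟩
  rw [← Over.w r, reassoc_of% h2, Over.w g, Over.w]

theorem exists_normalization_desc {V W : Over SpecC} {r : W ⟶ V}
    [IsIntegralHom r.left] {h : T ⟶ W} {g : S ⟶ V} (w : h ≫ r = f ≫ g) :
    ∃ l : normalization f ⟶ W, toNormalization f ≫ l = h ∧
      l ≫ r = fromNormalization f ≫ g := by
  obtain ⟨l, h1, h2⟩ := exists_desc_of_smooth (f := f.left) (p := 𝟙 S.left) (IsPullback.of_horiz_isIso ⟨by simp⟩ )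
    (a := 𝟙 _) (f' := f.left) (b := 𝟙 _) (q' := f.left.fromNormalization)
    (IsPullback.of_horiz_isIso ⟨by simp⟩) (j' := f.left.toNormalization)
    (by simp) (by simp)
    (r := r.left) (h := h.left) (g := g.left) (by rw [← Over.comp_left, w, Over.comp_left])
  have hl : l ≫ W.hom = f.left.fromNormalization ≫ S.hom := by
    rw [← Over.w r, reassoc_of% h2, Over.w g]
  exact ⟨Over.homMk l hl, Over.OverMorphism.ext h1, Over.OverMorphism.ext h2⟩

/-- `T` is scheme-theoretically dense in the normalization, and stays so after smooth base change.
Identities between actions can therefore be checked on the torus. -/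
theorem tensor_normalization_hom_ext {G W : Over SpecC} [Smooth G.hom] [IsSeparated W.hom]
    {a b : G ⊗ normalization f ⟶ W}
    (h : (G ◁ toNormalization f) ≫ a = (G ◁ toNormalization f) ≫ b) : a = b := by
  have := smooth_snd_left G (normalization f)
  have : QuasiCompact (toNormalization f).left :=
    inferInstanceAs (QuasiCompact f.left.toNormalization)
  have : IsSchemeTheoreticallyDominant (toNormalization f).left :=
    ⟨f.left.ker_toNormalization⟩
  have := IsSchemeTheoreticallyDominant.of_isPullback
    (isPullback_whiskerLeft_left G (toNormalization f))
  apply Over.OverMorphism.ext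
  refine ext_of_isSchemeTheoreticallyDominant W.hom (by rw [Over.w, Over.w])
    (G ◁ toNormalization f).left ?_
  rw [← Over.comp_left, h, Over.comp_left]

end

/-! ### The action of the torus on a relative normalization -/

section

variable {n : ℕ} (X : ToricVariety n) (φ : torus n ⟶ torus n)

/-- The composition of an endomorphism of the torus with the orbit map. -/
def powOrbit : torus n ⟶ X.X := φ ≫ X.orbit

theorem isAffineHom_torus_hom {Z : Over SpecC} [IsSeparated Z.hom] (f : torus n ⟶ Z) :
    IsAffineHom f.left := by
  have : IsAffineHom (f.left ≫ Z.hom) := by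
    rw [Over.w]
    change IsAffineHom (Spec.map _)
    infer_instance
  exact .of_comp _ Z.hom

instance : IsAffineHom (powOrbit X φ).left :=
  have := X.separated
  isAffineHom_torus_hom _

instance : Smooth (torus n).hom := smooth_torus n

/-- The normalization of `X` in the torus, along an isogeny `φ`. -/
def coverObj : Over SpecC := normalization (powOrbit X φ)

/-- The orbit map of the normalization. -/
def coverTo : torus n ⟶ coverObj X φ := toNormalization (powOrbit X φ)

/-- The normalization morphism to `X`. -/
def coverFrom : coverObj X φ ⟶ X.X := fromNormalization (powOrbit X φ)

@[simp]
theorem coverTo_coverFrom : coverTo X φ ≫ coverFrom X φ = φ ≫ X.orbit :=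
  toNormalization_fromNormalization (powOrbit X φ)

theorem isSeparated_coverObj : IsSeparated (coverObj X φ).hom := by
  have := X.separated
  change IsSeparated ((powOrbit X φ).left.fromNormalization ≫ X.X.hom)
  infer_instance

instance : IsIntegralHom (coverFrom X φ).left :=
  inferInstanceAs (IsIntegralHom (powOrbit X φ).left.fromNormalization)

theorem tensor_coverObj_hom_ext {G W : Over SpecC} [Smooth G.hom] (hW : IsSeparated W.hom)
    {a b : G ⊗ coverObj X φ ⟶ W} (h : (G ◁ coverTo X φ) ≫ a = (G ◁ coverTo X φ) ≫ b) : a = b :=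
  tensor_normalization_hom_ext h

variable [IsMonHom φ]

/-- Multiplication of the torus covers the action on `X` twisted by `φ`, because `φ` is a
homomorphism and the orbit map is equivariant; the universal property extends it to the whole
normalization. -/
theorem exists_coverAct : ∃ l : torus n ⊗ coverObj X φ ⟶ coverObj X φ,
    (torus n ◁ coverTo X φ) ≫ l = μ[torus n] ≫ coverTo X φ ∧
      l ≫ coverFrom X φ = (φ ⊗ₘ coverFrom X φ) ≫ X.act := by
  have w : (μ[torus n] ≫ coverTo X φ) ≫ coverFrom X φ =
      (torus n ◁ powOrbit X φ) ≫ (φ ▷ X.X) ≫ X.act := by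
    have h := X.orbit_equivariant
    rw [Category.assoc, coverTo_coverFrom, IsMonHom.mul_hom_assoc, h, powOrbit]
    change _ ≫ _ ≫ X.act = _
    rw [MonoidalCategory.tensorHom_def', Category.assoc, MonoidalCategory.whiskerLeft_comp,
      Category.assoc, ← whisker_exchange_assoc]
  obtain ⟨l, h1, h2⟩ := exists_tensor_normalization_desc (r := coverFrom X φ) w
  refine ⟨l, h1, h2.trans ?_⟩
  rw [MonoidalCategory.tensorHom_def', Category.assoc]
  rfl

/-- The action of the torus on the normalization. -/
def coverAct : torus n ⊗ coverObj X φ ⟶ coverObj X φ := (exists_coverAct X φ).choose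

theorem whiskerLeft_coverTo_coverAct :
    (torus n ◁ coverTo X φ) ≫ coverAct X φ = μ[torus n] ≫ coverTo X φ :=
  (exists_coverAct X φ).choose_spec.1

theorem coverAct_coverFrom : coverAct X φ ≫ coverFrom X φ = (φ ⊗ₘ coverFrom X φ) ≫ X.act :=
  (exists_coverAct X φ).choose_spec.2

/-- The module structure on the normalization given by the action of the torus. -/
@[reducible]
def coverModObj : ModObj (torus n) (coverObj X φ) where
  smul := coverAct X φ
  one_smul := by
    change η[torus n] ▷ coverObj X φ ≫ coverAct X φ = (λ_ (coverObj X φ)).hom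
    have : Smooth (𝟙_ (Over SpecC)).hom := inferInstanceAs (Smooth (𝟙 SpecC))
    -- On the torus the action is multiplication, so each module axiom reduces to the matching
    -- monoid axiom.
    refine tensor_coverObj_hom_ext X φ (G := 𝟙_ (Over SpecC)) (isSeparated_coverObj X φ) ?_
    rw [whisker_exchange_assoc, whiskerLeft_coverTo_coverAct, MonObj.one_mul_assoc,
      leftUnitor_naturality]
  mul_smul := by
    change μ[torus n] ▷ coverObj X φ ≫ coverAct X φ =
      (α_ (torus n) (torus n) (coverObj X φ)).hom ≫ torus n ◁ coverAct X φ ≫ coverAct X φ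
    have := smooth_tensor (torus n) (torus n)
    refine tensor_coverObj_hom_ext X φ (G := torus n ⊗ torus n) (isSeparated_coverObj X φ) ?_
    rw [whisker_exchange_assoc, whiskerLeft_coverTo_coverAct, MonObj.mul_assoc_assoc,
      tensor_whiskerLeft, Category.assoc, Category.assoc, Iso.inv_hom_id_assoc,
      ← MonoidalCategory.whiskerLeft_comp_assoc, whiskerLeft_coverTo_coverAct,
      MonoidalCategory.whiskerLeft_comp_assoc, whiskerLeft_coverTo_coverAct]

end

end ProalgebraicToric

end

/-! ### Finite and normal relative normalizations. -/

noncomputable section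

namespace ProalgebraicToric

/-! ### Finiteness and normality of relative normalizations -/

section

open Limits

variable {T S U : Scheme.{0}} (f : T ⟶ S) (φ : T ⟶ U) (i : U ⟶ S)

/-- Over the image of `i` the morphism `f` is the integral `φ`, so the normalization there is `T`
itself. -/
theorem isOpenImmersion_toNormalization [QuasiCompact f] [QuasiSeparated f] [IsIntegralHom φ]
    [IsOpenImmersion i] (hf : f = φ ≫ i) :
    ∃ _ : IsOpenImmersion f.toNormalization,
      f.fromNormalization ⁻¹ᵁ i.opensRange = f.toNormalization.opensRange := by
  have hT : IsPullback (𝟙 T) φ f i := by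
    refine ⟨⟨by simp [hf]⟩, ⟨PullbackCone.IsLimit.mk _ (fun s => s.fst) (by simp) ?_ ?_⟩⟩
    · intro s
      rw [← cancel_mono i, Category.assoc, ← hf, s.condition]
    · intro s m h _
      simpa using h
  let F := pullback.snd f i
  have : IsIntegralHom F := by
    have : F = hT.isoPullback.inv ≫ φ := by simp [F]
    rw [this]; infer_instance
  have key : hT.isoPullback.hom ≫ F.toNormalization ≫ f.normalizationPullback i ≫
      pullback.fst f.fromNormalization i = f.toNormalization := by
    simp [F]
  have h : IsOpenImmersion f.toNormalization := by
    rw [← key]; infer_instance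
  refine ⟨h, ?_⟩
  apply TopologicalSpace.Opens.ext
  change _ = Set.range f.toNormalization
  have : Set.range f.toNormalization = Set.range (pullback.fst f.fromNormalization i) := by
    conv_lhs => rw [← key]
    simp only [← Category.assoc]
    rw [Scheme.Hom.comp_base, TopCat.coe_comp]
    exact Function.Surjective.range_comp (Scheme.Hom.surjective _) _
  rw [this, Scheme.Pullback.range_fst]
  rfl

theorem charZero_sections (s : S ⟶ SpecC) (V : S.Opens) [Nonempty V] : CharZero Γ(S, V) := by
  let j : ℂ →+* Γ(S, V) := ((Scheme.ΓSpecIso (.of ℂ)).inv ≫ s.appLE ⊤ V (by simp)).hom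
  exact charZero_of_injective_ringHom j.injective

variable [IsAffineHom f] [IsIntegral T] [IsDominant f]

theorem finite_integralClosure_sections [IsIntegral S] [IsLocallyNoetherian S] (s : S ⟶ SpecC)
    (hS : ∀ x : S, IsIntegrallyClosed (S.presheaf.stalk x)) [IsFinite φ] [IsOpenImmersion i]
    (hf : f = φ ≫ i) (V : S.Opens) (hV : IsAffineOpen V) [Nonempty V] :
    letI := (f.app V).hom.toAlgebra
    Module.Finite Γ(S, V) (integralClosure Γ(S, V) Γ(T, f ⁻¹ᵁ V)) := by
  have hne : ((V ⊓ i.opensRange : S.Opens) : Set S).Nonempty := by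
    refine nonempty_preirreducible_inter V.2 i.opensRange.2 ?_ ?_
    · exact Set.nonempty_coe_sort.mp ‹_›
    · obtain ⟨t⟩ : Nonempty T := inferInstance
      exact ⟨i (φ t), φ t, rfl⟩
  obtain ⟨x, hxV, hxU⟩ := hne
  -- Over a basic open inside `V` and the image of `i`, `f` is the finite `φ`; inverting `h` gives
  -- the localization at which finiteness is known.
  obtain ⟨h, hle, hxh⟩ := hV.exists_basicOpen_le (V := i.opensRange) ⟨x, hxU⟩ hxV
  have : Nonempty (S.basicOpen h) := ⟨⟨x, hxh⟩⟩
  have hne' : Nonempty (f ⁻¹ᵁ S.basicOpen h : T.Opens) := by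
    obtain ⟨y, hy, t, rfl⟩ := f.denseRange.inter_open_nonempty _ (S.basicOpen h).2 ⟨x, hxh⟩
    exact ⟨⟨t, hy⟩⟩
  have hdom : IsSchemeTheoreticallyDominant f := .of_isDominant f
  have hhV : S.basicOpen h ≤ V := S.basicOpen_le h
  have hne'' : Nonempty (f ⁻¹ᵁ V : T.Opens) := ⟨⟨hne'.some.1, hhV hne'.some.2⟩⟩
  algebraize [(f.app V).hom, (f.app (S.basicOpen h)).hom, (S.presheaf.map (homOfLE hhV).op).hom,
    (T.presheaf.map (homOfLE (f.preimage_mono hhV)).op).hom, (f.appLE V (f ⁻¹ᵁ S.basicOpen h) (f.preimage_mono hhV)).hom]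
  have : IsScalarTower Γ(S, V) Γ(S, S.basicOpen h) Γ(T, f ⁻¹ᵁ S.basicOpen h) := .of_algebraMap_eq' <| by
        simp [RingHom.algebraMap_toAlgebra, ← CommRingCat.hom_comp]
        rfl
  have : IsScalarTower Γ(S, V) Γ(T, f ⁻¹ᵁ V) Γ(T, f ⁻¹ᵁ S.basicOpen h) := .of_algebraMap_eq' rfl
  have := charZero_sections s V
  have : IsIntegrallyClosed Γ(S, V) := isIntegrallyClosed_sections hS hV
  have : IsNoetherianRing Γ(S, V) := IsLocallyNoetherian.component_noetherian ⟨V, hV⟩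
  have : IsLocalization.Away h Γ(S, S.basicOpen h) := hV.isLocalization_basicOpen h
  have hfin : Module.Finite Γ(S, S.basicOpen h) Γ(T, f ⁻¹ᵁ S.basicOpen h) := by
    change (f.app (S.basicOpen h)).hom.Finite
    have := i.isIso_app _ hle
    have h1 := (φ.finite_app _ ((hV.basicOpen h).preimage_of_isOpenImmersion i hle)).comp
      (.of_surjective _ (ConcreteCategory.bijective_of_isIso (i.app (S.basicOpen h))).2)
    subst hf
    rw [Scheme.Hom.comp_app]
    exact h1
  refine finite_integralClosure_of_localization (A' := Γ(S, S.basicOpen h))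
    (B' := Γ(T, f ⁻¹ᵁ S.basicOpen h)) (h := h) ?_ ?_ ?_
  · rintro rfl
    simp at hxh
  · exact map_injective_of_isIntegral _ _
  · exact f.app_injective _

theorem isFinite_fromNormalization [IsIntegral S] [IsLocallyNoetherian S] (s : S ⟶ SpecC)
    (hS : ∀ x : S, IsIntegrallyClosed (S.presheaf.stalk x)) [IsFinite φ] [IsOpenImmersion i]
    (hf : f = φ ≫ i) : IsFinite f.fromNormalization := by
  refine { toIsAffineHom := inferInstance, finite_app := fun V hV => ?_ }
  rcases isEmpty_or_nonempty V with h | h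
  · have hV' : f.fromNormalization ⁻¹ᵁ V = ⊥ := by
      ext x
      exact ⟨fun hx => (h.false ⟨_, hx⟩).elim, fun hx => hx.elim⟩
    have : Subsingleton Γ(f.normalization, f.fromNormalization ⁻¹ᵁ V) := by
      rw [hV']
      infer_instance
    exact .of_surjective _ fun x => ⟨0, Subsingleton.elim _ _⟩
  · have := finite_integralClosure_sections f φ i s hS hf V hV
    algebraize [(f.app V).hom]
    rw [f.fromNormalization_app hV, CommRingCat.hom_comp]
    refine RingHom.Finite.comp (.of_surjective _
      (ConcreteCategory.bijective_of_isIso (f.normalizationObjIso hV).inv).2) ?_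
    exact RingHom.finite_algebraMap.mpr this

/-- Sections of the normalization over affine opens are integral closures inside the sections of
`T`, which are integrally closed domains. -/
theorem isIntegrallyClosed_normalization_stalk (hT : ∀ x : T, IsIntegrallyClosed (T.presheaf.stalk x))
    (x : f.normalization) : IsIntegrallyClosed (f.normalization.presheaf.stalk x) := by
  obtain ⟨_, ⟨V, hV, rfl⟩, hxV, -⟩ := S.isBasis_affineOpens.exists_subset_of_mem_open
    (Set.mem_univ (f.fromNormalization x)) isOpen_univ
  have hne' : Nonempty (f ⁻¹ᵁ V : T.Opens) := by
    obtain ⟨y, hy, t, rfl⟩ := f.denseRange.inter_open_nonempty _ V.2 ⟨_, hxV⟩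
    exact ⟨⟨t, hy⟩⟩
  have := isIntegrallyClosed_sections hT (hV.preimage f)
  algebraize [(f.app V).hom]
  have : IsIntegrallyClosed (integralClosure Γ(S, V) Γ(T, f ⁻¹ᵁ V)) :=
    IsIntegrallyClosed.of_isIntegrallyClosed_of_isIntegrallyClosedIn _ Γ(T, f ⁻¹ᵁ V)
  have : IsIntegrallyClosed Γ(f.normalization, f.fromNormalization ⁻¹ᵁ V) :=
    .of_equiv (f.normalizationObjIso hV).commRingCatIsoToRingEquiv.symm
  exact isIntegrallyClosed_stalk (hV.preimage f.fromNormalization) ⟨x, hxV⟩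

end

end ProalgebraicToric

end

/-! ### Covers attached to isogenies, and their cofinality. -/

noncomputable section

namespace ProalgebraicToric

/-! ### The toric cover defined by an isogeny -/

section

variable {n : ℕ}

instance : IsIntegral (torus n).left := by
  have := (isIntegrallyClosed_monoidAlgebra_lattice n ℂ).1
  change IsIntegral (Spec (.of (MonoidAlgebra ℂ (Lattice n))))
  infer_instance

theorem isIntegrallyClosed_torus_stalk (x : (torus n).left) :
    IsIntegrallyClosed ((torus n).left.presheaf.stalk x) := by
  obtain ⟨h1, h2⟩ := isIntegrallyClosed_monoidAlgebra_lattice n ℂ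
  have : IsIntegrallyClosed Γ((torus n).left, ⊤) :=
    IsIntegrallyClosed.of_equiv (R := MonoidAlgebra ℂ (Lattice n))
      (Scheme.ΓSpecIso (.of (MonoidAlgebra ℂ (Lattice n)))).commRingCatIsoToRingEquiv.symm
  have : IsAffine (torus n).left := inferInstanceAs (IsAffine (Spec _))
  exact isIntegrallyClosed_stalk (isAffineOpen_top (torus n).left) ⟨x, trivial⟩

theorem isDominant_torusHom {α : Lattice n →* Lattice n} (hα : Function.Injective α) :
    IsDominant (torusHom α).left := by
  rw [torusHom_left]
  refine ⟨PrimeSpectrum.denseRange_comap_iff_ker_le_nilRadical (coordRingHom α) |>.mpr ?_⟩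
  rw [(RingHom.injective_iff_ker_eq_bot _).mp (MonoidAlgebra.mapDomain_injective hα)]
  exact bot_le

theorem pow_injective_lattice {N : ℕ} (hN : 0 < N) :
    Function.Injective (powMonoidHom N : Lattice n →* Lattice n) := by
  intro a b h
  apply Multiplicative.toAdd.injective
  have : N • a.toAdd = N • b.toAdd := congrArg Multiplicative.toAdd h
  exact nsmul_right_injective hN.ne' this

variable (X : ToricVariety n) (φ : torus n ⟶ torus n) [IsFinite φ.left] [IsDominant φ.left]

instance : IsDominant (powOrbit X φ).left := by
  have := X.integral
  have := X.isOpenImmersion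
  have : IsDominant X.orbit.left :=
    ⟨X.orbit.left.isOpenEmbedding.isOpen_range.dense (Set.range_nonempty _)⟩
  change IsDominant (φ.left ≫ X.orbit.left)
  infer_instance

theorem isFinite_coverFrom : IsFinite (coverFrom X φ).left := by
  have := X.integral
  have := X.isOpenImmersion
  have := X.finiteType
  have : IsLocallyNoetherian X.X.left := LocallyOfFiniteType.isLocallyNoetherian X.X.hom
  exact isFinite_fromNormalization (powOrbit X φ).left φ.left X.orbit.left X.X.hom X.normal rfl

variable [IsMonHom φ]

/-- The toric variety obtained by normalizing `X` in the torus along an isogeny. -/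
def coverVariety : ToricVariety n where
  X := coverObj X φ
  integral := inferInstanceAs (IsIntegral (powOrbit X φ).left.normalization)
  separated := isSeparated_coverObj X φ
  finiteType := by
    have := isFinite_coverFrom X φ
    have := X.finiteType
    rw [← Over.w (coverFrom X φ)]
    infer_instance
  quasiCompact := by
    have := isFinite_coverFrom X φ
    have := X.quasiCompact
    rw [← Over.w (coverFrom X φ)]
    infer_instance
  normal := isIntegrallyClosed_normalization_stalk (powOrbit X φ).left
    isIntegrallyClosed_torus_stalk
  action := coverModObj X φ
  orbit := coverTo X φ
  isOpenImmersion :=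
    have := X.isOpenImmersion
    (isOpenImmersion_toNormalization (powOrbit X φ).left φ.left X.orbit.left rfl).1
  orbit_equivariant := (whiskerLeft_coverTo_coverAct X φ).symm

/-- The toric cover of `X` defined by an isogeny of tori. -/
def isogenyCover : ToricCover X where
  Y := coverVariety X φ
  toHom :=
    { f := coverFrom X φ
      φ := φ
      isMonHom := inferInstance
      orbit_comp := coverTo_coverFrom X φ
      equivariant := coverAct_coverFrom X φ }
  finite := isFinite_coverFrom X φ
  preimage :=
    have := X.isOpenImmersion
    (isOpenImmersion_toNormalization (powOrbit X φ).left φ.left X.orbit.left rfl).2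

/-- `c` is finite over `X`, so the universal property extends `ψ ≫ c.Y.orbit` to the normalization;
equivariance holds on the torus, hence everywhere. -/
theorem exists_toricHom_isogenyCover (c : ToricCover X) (ψ : torus n ⟶ torus n) [IsMonHom ψ]
    (h : ψ ≫ c.toHom.φ = φ) : ∃ k : ToricHom (isogenyCover X φ).Y c.Y,
      k.f ≫ c.toHom.f = (isogenyCover X φ).toHom.f ∧ k.φ = ψ := by
  have := c.finite
  have H : ∃ l : coverObj X φ ⟶ c.Y.X, coverTo X φ ≫ l = ψ ≫ c.Y.orbit ∧
      l ≫ c.toHom.f = coverFrom X φ ≫ 𝟙 _ :=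
    exists_normalization_desc (f := powOrbit X φ) (by
      rw [Category.assoc, c.toHom.orbit_comp, reassoc_of% h, Category.comp_id]
      rfl)
  obtain ⟨l, h1, h2⟩ := H
  have h3 : μ[torus n] ≫ c.Y.orbit = (torus n ◁ c.Y.orbit) ≫ c.Y.act := c.Y.orbit_equivariant
  have h4 : coverAct X φ ≫ l = (ψ ⊗ₘ l) ≫ c.Y.act := by
    refine tensor_coverObj_hom_ext X φ c.Y.separated ?_
    rw [reassoc_of% whiskerLeft_coverTo_coverAct X φ, h1, IsMonHom.mul_hom_assoc, h3,
      MonoidalCategory.tensorHom_def, MonoidalCategory.tensorHom_def, Category.assoc,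
      Category.assoc, whisker_exchange_assoc, ← MonoidalCategory.whiskerLeft_comp_assoc,
      ← MonoidalCategory.whiskerLeft_comp_assoc, h1]
  exact ⟨⟨l, ψ, inferInstance, h1, h4⟩, h2.trans (Category.comp_id _), rfl⟩

/-- Since the principal orbit of the cover is the full preimage of `U`, `φ` is the base change of
the finite `f` along the orbit map of `X`. -/
theorem isFinite_cover_φ (c : ToricCover X) : IsFinite c.toHom.φ.left := by
  have := X.isOpenImmersion
  have := c.Y.isOpenImmersion
  have := c.finite
  let p := Limits.pullback.fst c.toHom.f.left X.orbit.left
  let e := IsOpenImmersion.isoOfRangeEq c.Y.orbit.left p (by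
    rw [Scheme.Pullback.range_fst]
    exact congrArg SetLike.coe c.preimage.symm)
  have he : e.hom ≫ p = c.Y.orbit.left := IsOpenImmersion.isoOfRangeEq_hom_fac _ _ _
  have hs : e.hom ≫ Limits.pullback.snd c.toHom.f.left X.orbit.left = c.toHom.φ.left := by
    rw [← cancel_mono X.orbit.left, Category.assoc, ← Limits.pullback.condition, reassoc_of% he,
      ← Over.comp_left, c.toHom.orbit_comp, Over.comp_left]
  rw [← hs]
  infer_instance

theorem isIntegral_coordRingHom {α : Lattice n →* Lattice n} (h : IsFinite (torusHom α).left) :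
    (coordRingHom α).IsIntegral := by
  rw [torusHom_left] at h
  exact ((IsFinite.SpecMap_iff (CommRingCat.ofHom (coordRingHom α))).1 h).to_isIntegral

/-- Every toric cover is dominated by the cover of a power map. -/
theorem exists_cover_lift (c : ToricCover X) : ∃ (α β : Lattice n →* Lattice n) (N : ℕ), 0 < N ∧
    c.toHom.φ = torusHom α ∧ α.comp β = powMonoidHom N ∧ β.comp α = powMonoidHom N := by
  have := c.toHom.isMonHom
  obtain ⟨α, hα⟩ := exists_eq_torusHom c.toHom.φ
  obtain ⟨N, β, hN, h1, h2⟩ := exists_comp_eq_pow (exists_pow_mem_range_of_isIntegral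
    (isIntegral_coordRingHom (α := α) (hα ▸ isFinite_cover_φ X c)))
  exact ⟨α, β, N, hN, hα, h1, h2⟩

/-- The toric cover of `X` defined by the `N`-th power map. -/
def powCover (N : ℕ+) : ToricCover X :=
  have := isFinite_torusHom_pow (n := n) N.pos
  have := isDominant_torusHom (pow_injective_lattice (n := n) N.pos)
  isogenyCover X (torusHom (powMonoidHom (N : ℕ)))

theorem powCover_φ (N : ℕ+) : (powCover X N).toHom.φ = torusHom (powMonoidHom (N : ℕ)) := rfl

theorem exists_toricHom_powCover (c : ToricCover X) {α β : Lattice n →* Lattice n} {N : ℕ+}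
    (hc : c.toHom.φ = torusHom α) (h : β.comp α = powMonoidHom (N : ℕ)) :
    ∃ k : ToricHom (powCover X N).Y c.Y,
      k.f ≫ c.toHom.f = (powCover X N).toHom.f ∧ k.φ = torusHom β := by
  have := isFinite_torusHom_pow (n := n) N.pos
  have := isDominant_torusHom (pow_injective_lattice (n := n) N.pos)
  exact exists_toricHom_isogenyCover X (torusHom (powMonoidHom (N : ℕ))) c (torusHom β)
    (by rw [hc, ← torusHom_comp, h])

end

end ProalgebraicToric

end

/-! ### Lifting points through finite extensions, and analytic density. -/

noncomputable section

namespace ProalgebraicToric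

/-! ### Specializations of integral extensions -/

section

open Polynomial

/-- A maximal ideal lies over the kernel of `φ`, and its residue field, algebraic over that of the
kernel, embeds into `K`. -/
theorem exists_ringHom_extension {R A K : Type*} [CommRing R] [CommRing A] [Field K]
    [IsAlgClosed K] [Algebra R A] [Algebra.IsIntegral R A]
    (hinj : Function.Injective (algebraMap R A)) (φ : R →+* K) (hφ : Function.Surjective φ) :
    ∃ ψ : A →+* K, ψ.comp (algebraMap R A) = φ := by
  have hP : (RingHom.ker φ).IsMaximal := RingHom.ker_isMaximal_of_surjective φ hφ
  obtain ⟨Q, hQ, hQP⟩ := Ideal.exists_ideal_over_maximal_of_isIntegral (S := A) (RingHom.ker φ)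
    (by rw [(RingHom.injective_iff_ker_eq_bot _).mp hinj]; exact bot_le)
  have : Q.LiesOver (RingHom.ker φ) := ⟨hQP.symm⟩
  let := Ideal.Quotient.field (RingHom.ker φ)
  let := Ideal.Quotient.field Q
  let : Algebra (R ⧸ RingHom.ker φ) K := (RingHom.kerLift φ).toAlgebra
  let l : A ⧸ Q →ₐ[R ⧸ RingHom.ker φ] K := IsAlgClosed.lift
  refine ⟨l.toRingHom.comp (Ideal.Quotient.mk Q), RingHom.ext fun r => ?_⟩
  exact l.commutes (Ideal.Quotient.mk _ r)

/-- Over an integrally closed domain, the values of an integral element at the points over a given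
point are all the roots of the specialized minimal polynomial. -/
theorem exists_ringHom_apply_eq {R A K : Type*} [CommRing R] [IsDomain R] [IsIntegrallyClosed R]
    [CommRing A] [IsDomain A] [Field K] [IsAlgClosed K] [Algebra R A] [Algebra.IsIntegral R A]
    (hinj : Function.Injective (algebraMap R A)) (φ : R →+* K) (hφ : Function.Surjective φ) (a : A)
    {t : K} (ht : ((minpoly R a).map φ).IsRoot t) :
    ∃ ψ : A →+* K, ψ.comp (algebraMap R A) = φ ∧ ψ a = t := by
  have : FaithfulSMul R A := (faithfulSMul_iff_algebraMap_injective R A).2 hinj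
  have ha : IsIntegral R a := Algebra.IsIntegral.isIntegral a
  -- As `R` is integrally closed, `R[a]` is `R[X]` modulo the minimal polynomial, so `a ↦ t` is
  -- allowed; the rest of `A` is integral over `R[a]`.
  let φ' : AdjoinRoot (minpoly R a) →+* K := AdjoinRoot.lift φ t (by rwa [← Polynomial.eval_map])
  let e := minpoly.equivAdjoin ha
  let φ'' : Algebra.adjoin R {a} →+* K := φ'.comp e.symm.toRingEquiv.toRingHom
  have h1 (r : R) : φ'' (algebraMap R _ r) = φ r := by
    have : e.symm (algebraMap R _ r) = AdjoinRoot.of _ r := e.symm.commutes r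
    simp [φ'', φ', this]
  have h2 : φ'' ⟨a, Algebra.self_mem_adjoin_singleton R a⟩ = t := by
    have : e (AdjoinRoot.root _) = ⟨a, Algebra.self_mem_adjoin_singleton R a⟩ := by
      simp [e, AdjoinRoot.Minpoly.toAdjoin]
    simp [φ'', φ', ← this]
  have : Algebra.IsIntegral (Algebra.adjoin R {a}) A := .tower_top R
  obtain ⟨ψ, hψ⟩ := exists_ringHom_extension (A := A) Subtype.val_injective φ''
    (fun k => (hφ k).imp' (algebraMap R _) fun r hr => (h1 r).trans hr)
  refine ⟨ψ, RingHom.ext fun r => ?_, ?_⟩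
  · rw [← h1, ← hψ]; rfl
  · rw [← h2, ← hψ]; rfl

theorem norm_pow_card_le_norm_prod {s : Multiset ℂ} {r : ℝ} (hr : 0 ≤ r) (h : ∀ z ∈ s, r ≤ ‖z‖) :
    r ^ Multiset.card s ≤ ‖s.prod‖ := by
  induction s using Multiset.induction with
  | empty => simp
  | cons z s ih =>
    rw [Multiset.card_cons, Multiset.prod_cons, norm_mul, pow_succ']
    exact mul_le_mul (h z (by simp)) (ih fun w hw => h w (by simp [hw])) (by positivity)
      (norm_nonneg _)

/-- Take a root of least norm: the product of all roots is the constant coefficient up to sign. -/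
theorem exists_isRoot_norm_pow_le {P : ℂ[X]} (hP : P.Monic) (hd : 0 < P.natDegree) :
    ∃ t, P.IsRoot t ∧ ‖t‖ ^ P.natDegree ≤ ‖P.coeff 0‖ := by
  have hs := IsAlgClosed.splits P
  have hc : P.roots.card = P.natDegree := hs.natDegree_eq_card_roots.symm
  have hne : P.roots.toFinset.Nonempty := by
    rw [Multiset.toFinset_nonempty, ← Multiset.card_pos, hc]
    exact hd
  obtain ⟨t, ht, hmin⟩ := P.roots.toFinset.exists_min_image (fun z => ‖z‖) hne
  refine ⟨t, isRoot_of_mem_roots (Multiset.mem_toFinset.mp ht), ?_⟩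
  rw [hs.coeff_zero_eq_prod_roots_of_monic hP, norm_mul, norm_pow, norm_neg, norm_one, one_pow,
    one_mul, ← hc]
  exact norm_pow_card_le_norm_prod (norm_nonneg _) fun z hz => hmin z (Multiset.mem_toFinset.mpr hz)

/-- Cauchy's bound, with a sum for the maximum, so that it converges when the coefficients do. -/
theorem norm_le_of_isRoot_of_monic {P : ℂ[X]} (hP : P.Monic) {t : ℂ} (ht : P.IsRoot t) :
    ‖t‖ ≤ ∑ i ∈ Finset.range P.natDegree, ‖P.coeff i‖ + 1 := by
  have h := NNReal.coe_le_coe.2 (ht.norm_lt_cauchyBound hP.ne_zero).le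
  refine h.trans ?_
  rw [cauchyBound, hP.leadingCoeff, nnnorm_one, div_one]
  have : (Finset.sup (Finset.range P.natDegree) fun i => ‖P.coeff i‖₊) ≤
      ∑ i ∈ Finset.range P.natDegree, ‖P.coeff i‖₊ :=
    Finset.sup_le fun i hi => Finset.single_le_sum (f := fun i => ‖P.coeff i‖₊)
      (fun _ _ => zero_le) hi
  have := NNReal.coe_le_coe.2 this
  push_cast at this ⊢
  simpa using this

theorem isRoot_minpoly_map {R A : Type*} [CommRing R] [CommRing A] [Algebra R A]
    (φ : R →+* ℂ) {ψ : A →+* ℂ} (h : ψ.comp (algebraMap R A) = φ) (a : A) :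
    ((minpoly R a).map φ).IsRoot (ψ a) := by
  rw [IsRoot, ← h, ← map_map, Polynomial.eval_map, eval₂_hom, Polynomial.eval_map,
    ← Polynomial.aeval_def, minpoly.aeval, map_zero]

/-- A point over `y` is determined by its values on finitely many generators, each a root of a
specialized minimal polynomial. -/
theorem finite_setOf_comp_eq {R A : Type*} [CommRing R] [CommRing A] [Algebra R A]
    [Module.Finite R A] (y : R →+* ℂ) : {z : A →+* ℂ | z.comp (algebraMap R A) = y}.Finite := by
  obtain ⟨s, hs⟩ := Module.Finite.fg_top (R := R) (M := A)
  let res : (A →+* ℂ) → (s → ℂ) := fun z b => z b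
  have hfin : (Set.univ.pi fun b : s => (((minpoly R (b : A)).map y).rootSet ℂ : Set ℂ)).Finite :=
    Set.Finite.pi fun b => Polynomial.rootSet_finite _ _
  refine Set.Finite.of_finite_image (f := res) (hfin.subset ?_) ?_
  · rintro _ ⟨z, hz, rfl⟩ b -
    have hm : ((minpoly R (b : A)).map y).Monic :=
      (minpoly.monic (Algebra.IsIntegral.isIntegral _)).map y
    rw [mem_rootSet, coe_aeval_eq_eval]
    exact ⟨hm.ne_zero, isRoot_minpoly_map y hz _⟩
  · intro z hz w hw h
    ext b
    have hb : b ∈ Submodule.span R (s : Set A) := hs ▸ Submodule.mem_top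
    induction hb using Submodule.span_induction with
    | mem b hb => exact congrFun h ⟨b, hb⟩
    | zero => simp
    | add a b _ _ ha hb => rw [map_add, map_add, ha, hb]
    | smul r b _ hb =>
      have h1 := RingHom.congr_fun hz r
      have h2 := RingHom.congr_fun hw r
      simp only [RingHom.comp_apply] at h1 h2
      rw [Algebra.smul_def, map_mul, map_mul, hb, h1, h2]

/-- Prime avoidance among the finitely many points of the fibre: if `ker x ≤ ker z`, then `z = x`,
because `R` already surjects onto `ℂ`. -/
theorem exists_separating_element {R A : Type*} [CommRing R] [CommRing A] [Algebra R A]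
    [Module.Finite R A] (x : A →+* ℂ) (hx : Function.Surjective (x.comp (algebraMap R A))) :
    ∃ a, x a = 0 ∧ ∀ z : A →+* ℂ, z.comp (algebraMap R A) = x.comp (algebraMap R A) →
      z a = 0 → z = x := by
  classical
  let F : Finset (A →+* ℂ) := (finite_setOf_comp_eq (x.comp (algebraMap R A))).toFinset.erase x
  by_contra! H
  have hsub : (RingHom.ker x : Set A) ⊆ ⋃ z ∈ (F : Set (A →+* ℂ)), (RingHom.ker z : Set A) := by
    intro a ha
    obtain ⟨z, hz, hza, hne⟩ := H a ha
    simp only [Set.mem_iUnion]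
    exact ⟨z, by simp [F, hne, hz], hza⟩
  obtain ⟨z, hz, hle⟩ := (Ideal.subset_union_prime x x fun z _ _ _ => RingHom.ker_isPrime z).1 hsub
  have hz' : z ≠ x ∧ z.comp (algebraMap R A) = x.comp (algebraMap R A) := by simpa [F] using hz
  refine hz'.1 (RingHom.ext fun b => ?_)
  obtain ⟨r, hr⟩ := hx (x b)
  have h1 : b - algebraMap R A r ∈ RingHom.ker x := by
    rw [RingHom.mem_ker, map_sub, sub_eq_zero, ← hr]; rfl
  have h2 := hle h1
  rw [RingHom.mem_ker, map_sub, sub_eq_zero] at h2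
  rw [h2, ← hr]
  exact RingHom.congr_fun hz'.2 r

open Topology Filter

/-- A complex point of a finite extension `A` of an integrally closed domain `R` is a limit of
points over any family of points of `R` that converges to its image. -/
theorem exists_tendsto_lift {R A κ : Type*} [CommRing R] [IsDomain R] [IsIntegrallyClosed R]
    [CommRing A] [IsDomain A] [Algebra R A] [Module.Finite R A]
    (hinj : Function.Injective (algebraMap R A)) (x : A →+* ℂ)
    (hx : Function.Surjective (x.comp (algebraMap R A))) (l : Filter κ) [l.NeBot]
    (y : κ → R →+* ℂ) (hy : ∀ i, Function.Surjective (y i))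
    (hl : ∀ r, Tendsto (fun i => y i r) l (𝓝 (x (algebraMap R A r)))) :
    ∃ (G : Ultrafilter κ) (z : κ → A →+* ℂ), ↑G ≤ l ∧ (∀ i, (z i).comp (algebraMap R A) = y i) ∧
      ∀ b, Tendsto (fun i => z i b) G (𝓝 (x b)) := by
  obtain ⟨a, ha, hsep⟩ := exists_separating_element (R := R) x hx
  have hint (b : A) : IsIntegral R b := Algebra.IsIntegral.isIntegral b
  have hdeg (b : A) (i : κ) : ((minpoly R b).map (y i)).natDegree = (minpoly R b).natDegree :=
    (minpoly.monic (hint b)).natDegree_map _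
  have hmon (b : A) (i : κ) : ((minpoly R b).map (y i)).Monic := (minpoly.monic (hint b)).map _
  -- Of all lifts of `y i`, take one with `|z a|` least: since `x a = 0`, the constant coefficient
  -- of the specialized minimal polynomial tends to `0`, and so does `z i a`.
  have hroot (i : κ) : ∃ z : A →+* ℂ, z.comp (algebraMap R A) = y i ∧
      ‖z a‖ ^ (minpoly R a).natDegree ≤ ‖y i ((minpoly R a).coeff 0)‖ := by
    obtain ⟨t, ht, hle⟩ := exists_isRoot_norm_pow_le (hmon a i)
      (by rw [hdeg]; exact minpoly.natDegree_pos (hint a))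
    obtain ⟨z, hz, rfl⟩ := exists_ringHom_apply_eq hinj (y i) (hy i) a ht
    exact ⟨z, hz, by rwa [hdeg, coeff_map] at hle⟩
  choose z hz hza using hroot
  let G := Ultrafilter.of l
  have hG : ↑G ≤ l := Ultrafilter.of_le l
  -- Values at the lifts stay bounded, so they converge along an ultrafilter. The limit is a point
  -- of the fibre of `x` that kills `a`, hence `x`.
  have hlim (b : A) : ∃ c, Tendsto (fun i => z i b) G (𝓝 c) := by
    have hsum : Tendsto (fun i => ∑ k ∈ Finset.range (minpoly R b).natDegree,
        ‖y i ((minpoly R b).coeff k)‖ + 1) l (𝓝 (∑ k ∈ Finset.range (minpoly R b).natDegree,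
        ‖x (algebraMap R A ((minpoly R b).coeff k))‖ + 1)) :=
      (tendsto_finsetSum _ fun k _ => (hl _).norm).add_const 1
    obtain ⟨C, hC⟩ := hsum.isBoundedUnder_le.eventually_le
    have hb : ∀ᶠ i in G, z i b ∈ Metric.closedBall (0 : ℂ) C := by
      filter_upwards [hG hC] with i hi
      rw [mem_closedBall_zero_iff]
      refine (norm_le_of_isRoot_of_monic (hmon b i) (isRoot_minpoly_map _ (hz i) b)).trans ?_
      simpa [hdeg, coeff_map] using hi
    obtain ⟨c, -, hc⟩ := (isCompact_closedBall (0 : ℂ) C).ultrafilter_le_nhds (G.map fun i => z i b)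
      (le_principal_iff.2 hb)
    exact ⟨c, hc⟩
  choose L hL using hlim
  let x' : A →+* ℂ :=
    { toFun := L
      map_one' := tendsto_nhds_unique (hL 1) (by simp)
      map_zero' := tendsto_nhds_unique (hL 0) (by simp)
      map_mul' := fun b c => tendsto_nhds_unique (hL _) (by simpa using (hL b).mul (hL c))
      map_add' := fun b c => tendsto_nhds_unique (hL _) (by simpa using (hL b).add (hL c)) }
  have hx'R : x'.comp (algebraMap R A) = x.comp (algebraMap R A) := by
    refine RingHom.ext fun r => tendsto_nhds_unique (hL _) ?_
    refine ((hl r).mono_left hG).congr fun i => ?_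
    rw [← hz i]; rfl
  have hx'a : x' a = 0 := by
    have h0 : x (algebraMap R A ((minpoly R a).coeff 0)) = 0 := by
      have := isRoot_minpoly_map (x.comp (algebraMap R A)) rfl a
      rwa [ha, IsRoot, ← coeff_zero_eq_eval_zero, coeff_map] at this
    have h1 : Tendsto (fun i => ‖z i a‖ ^ (minpoly R a).natDegree) G (𝓝 0) := by
      refine squeeze_zero (fun i => by positivity) hza ?_
      simpa [h0] using ((hl ((minpoly R a).coeff 0)).mono_left hG).norm
    have h2 := tendsto_nhds_unique (((hL a).norm).pow (minpoly R a).natDegree) h1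
    exact norm_eq_zero.1 (pow_eq_zero_iff (minpoly.natDegree_pos (hint a)).ne' |>.1 h2)
  have hxx' : x' = x := hsep x' hx'R hx'a
  exact ⟨G, z, hG, hz, fun b => hxx' ▸ hL b⟩

/-- Otherwise dividing by `X` leaves a polynomial of smaller degree killing `h`, which the minimal
polynomial must divide. -/
theorem coeff_zero_minpoly_ne_zero {R A : Type*} [CommRing R] [IsDomain R] [IsIntegrallyClosed R]
    [CommRing A] [IsDomain A] [Algebra R A] [Algebra.IsIntegral R A] [FaithfulSMul R A] {h : A}
    (hh : h ≠ 0) : (minpoly R h).coeff 0 ≠ 0 := by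
  intro h0
  have hint : IsIntegral R h := Algebra.IsIntegral.isIntegral h
  have e : X * (minpoly R h).divX = minpoly R h := by
    simpa [h0] using X_mul_divX_add (minpoly R h)
  have hd : (minpoly R h).divX ≠ 0 := fun hd => minpoly.ne_zero hint (by rw [← e, hd, mul_zero])
  have h1 : aeval h (minpoly R h).divX = 0 := by
    have := congrArg (aeval h) e
    rw [map_mul, aeval_X, minpoly.aeval] at this
    exact (mul_eq_zero.1 this).resolve_left hh
  have h2 := natDegree_le_of_dvd (minpoly.isIntegrallyClosed_dvd hint h1) hd
  rw [natDegree_divX_eq_natDegree_tsub_one] at h2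
  have := minpoly.natDegree_pos hint
  omega

/-- A complex point of an affine variety is a limit of points where a given nonzero function does
not vanish. -/
theorem exists_tendsto_algHom {A : Type*} [CommRing A] [IsDomain A] [Algebra ℂ A]
    [Algebra.FiniteType ℂ A] (x : A →ₐ[ℂ] ℂ) {h : A} (hh : h ≠ 0) :
    ∃ (l : Ultrafilter ℂ) (z : ℂ → A →ₐ[ℂ] ℂ), (∀ᶠ t in l, z t h ≠ 0) ∧
      ∀ b, Tendsto (fun t => z t b) l (𝓝 (x b)) := by
  obtain ⟨s, g, hg, hfin⟩ := exists_finite_inj_algHom_of_fg ℂ A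
  let R := MvPolynomial (Fin s) ℂ
  let : Algebra R A := g.toRingHom.toAlgebra
  have : Module.Finite R A := hfin
  have : IsScalarTower ℂ R A := .of_algebraMap_eq' g.comp_algebraMap.symm
  have hinj : Function.Injective (algebraMap R A) := hg
  have : FaithfulSMul R A := (faithfulSMul_iff_algebraMap_injective R A).2 hinj
  -- If `h` vanishes at a point, `p` vanishes at its image in affine space; so it suffices to
  -- approach `y₀` through points with `p ≠ 0`.
  let p : R := (minpoly R h).coeff 0
  have hp : p ≠ 0 := coeff_zero_minpoly_ne_zero hh
  let y₀ : Fin s → ℂ := fun i => x (g (.X i))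
  have hy₀ (r : R) : x (g r) = MvPolynomial.aeval y₀ r := by
    rw [← AlgHom.comp_apply, MvPolynomial.aeval_unique (x.comp g)]
    rfl
  obtain ⟨y₁, hy₁⟩ : ∃ y₁ : Fin s → ℂ, MvPolynomial.eval y₁ p ≠ 0 := by
    by_contra! H
    exact hp (MvPolynomial.funext fun y => by simpa using H y)
  -- On the line from `y₀` to `y₁`, `p` is analytic in `t` and nonzero at `t = 1`, so `0` is at most
  -- an isolated zero.
  let c : ℂ → Fin s → ℂ := fun t => y₀ + t • (y₁ - y₀)
  let y : ℂ → R →ₐ[ℂ] ℂ := fun t => MvPolynomial.aeval (c t)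
  have hc : Continuous c := by fun_prop
  have hyc (r : R) : Continuous fun t => y t r := by
    have := (MvPolynomial.continuous_eval r).comp hc
    exact this
  have hsurj (f : R →ₐ[ℂ] ℂ) : Function.Surjective f := fun w => ⟨algebraMap ℂ R w, f.commutes w⟩
  have hne : ∀ᶠ t in 𝓝[≠] (0 : ℂ), y t p ≠ 0 := by
    by_contra H
    have hA : AnalyticOnNhd ℂ (fun t => y t p) Set.univ :=
      AnalyticOnNhd.aeval_mvPolynomial (fun i => by
        simp only [c, Pi.add_apply, Pi.smul_apply]
        exact analyticOnNhd_const.add (analyticOnNhd_id.smul analyticOnNhd_const)) p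
    have := hA.eqOn_zero_of_preconnected_of_frequently_eq_zero isPreconnected_univ
      (Set.mem_univ 0) (fun h => H h) (Set.mem_univ 1)
    refine hy₁ ?_
    have h1 : y 1 p = 0 := this
    have h2 : c 1 = y₁ := by simp [c]
    rw [← h2]
    exact h1
  obtain ⟨G, z, hG, hz, hlim⟩ := exists_tendsto_lift hinj x.toRingHom
    (hsurj (x.comp g)) (𝓝[≠] (0 : ℂ)) (fun t => (y t).toRingHom) (fun t => hsurj (y t)) (fun r => by
      have := ((hyc r).tendsto 0).mono_left (nhdsWithin_le_nhds (s := {0}ᶜ))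
      have h0 : y 0 r = x (g r) := by
        rw [hy₀]
        simp only [y, c, zero_smul, add_zero]
      rwa [h0] at this)
  refine ⟨G, fun t => { z t with commutes' := fun w => ?_ }, ?_, hlim⟩
  · have h1 := RingHom.congr_fun (hz t) (algebraMap ℂ R w)
    rw [RingHom.comp_apply, ← IsScalarTower.algebraMap_apply ℂ R A] at h1
    exact h1.trans ((y t).commutes w)
  · filter_upwards [hG hne] with t ht h0
    apply ht
    have := isRoot_minpoly_map _ (hz t) h
    change z t h = 0 at h0
    rw [h0, IsRoot, ← coeff_zero_eq_eval_zero, coeff_map] at this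
    exact this

/-! ### Density of Zariski open sets -/

namespace Points

variable {X : Over SpecC}

theorem tendsto_of_eval {κ : Type*} {l : Filter κ} {g : κ → Points X} {x : Points X}
    {V : X.left.Opens} (hV : IsAffineOpen V) (hx : x.Mem V) (hg : ∀ i, (g i).Mem V)
    (h : ∀ s : Γ(X.left, V), Tendsto (fun i => (g i).value (hg i) s) l (𝓝 (x.value hx s))) :
    Tendsto g l (𝓝 x) := by
  rw [TopologicalSpace.tendsto_nhds_generateFrom_iff]
  rintro _ ⟨U, s, W, hW, rfl⟩ ⟨hU, hmem⟩
  obtain ⟨f, k, m, hne, H⟩ := exists_value_eq_div hV hx hU s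
  have c1 := (h k).div ((h f).pow m) (pow_ne_zero _ hne)
  obtain ⟨_, h2⟩ := H x hx hne
  rw [← h2] at c1
  filter_upwards [(h f).eventually_ne hne, c1.eventually_mem (hW.mem_nhds hmem)] with b hb hbW
  obtain ⟨h3, h4⟩ := H (g b) (hg b) hb
  exact ⟨h3, h4 ▸ hbW⟩

theorem le_hom_preimage_top (V : X.left.Opens) : V ≤ X.hom ⁻¹ᵁ ⊤ := le_top

/-- The algebra homomorphism `ℂ → Γ(X, V)`. -/
def sectionAlg (V : X.left.Opens) : ℂ →+* Γ(X.left, V) :=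
  ((Scheme.ΓSpecIso (.of ℂ)).inv ≫ X.hom.appLE ⊤ V (le_hom_preimage_top V)).hom

theorem value_sectionAlg (x : Points X) {V : X.left.Opens} (hx : x.Mem V) (w : ℂ) :
    x.value hx (sectionAlg V w) = w := by
  have h : X.hom.appLE ⊤ V (le_hom_preimage_top V) ≫ x.hom.appLE V ⊤ hx.top_le = 𝟙 _ := by
    rw [Scheme.Hom.appLE_comp_appLE]
    simp only [x.hom_comp]
    exact (Category.id_comp _).trans (SpecC.presheaf.map_id _)
  have h' : (Scheme.ΓSpecIso (.of ℂ)).inv ≫ X.hom.appLE ⊤ V (le_hom_preimage_top V) ≫ x.hom.appLE V ⊤ hx.top_le ≫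
      (Scheme.ΓSpecIso (.of ℂ)).hom = 𝟙 _ := by
    rw [reassoc_of% h, Iso.inv_hom_id]
  exact ConcreteCategory.congr_hom h' w

/-- The complex point of an affine open defined by a homomorphism to `ℂ`. -/
theorem exists_value_eq {V : X.left.Opens} (hV : IsAffineOpen V) (f : Γ(X.left, V) →+* ℂ)
    (hf : ∀ w, f (sectionAlg V w) = w) :
    ∃ (x : Points X) (hx : x.Mem V), ∀ s, x.value hx s = f s := by
  let F : Γ(X.left, V) ⟶ .of ℂ := CommRingCat.ofHom f
  have hF : (Scheme.ΓSpecIso (.of ℂ)).inv ≫ X.hom.appLE ⊤ V (le_hom_preimage_top V) ≫ F = 𝟙 _ := by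
    ext w
    exact hf w
  have h1 : (Spec.map F ≫ hV.fromSpec) ≫ X.hom = 𝟙 SpecC := by
    have h2 := IsAffineOpen.SpecMap_appLE_fromSpec X.hom (isAffineOpen_top SpecC) hV (le_hom_preimage_top V)
    rw [Category.assoc, ← h2, IsAffineOpen.fromSpec_top, Scheme.isoSpec_Spec_inv,
      ← Spec.map_comp, ← Spec.map_comp, Category.assoc, hF, Spec.map_id]
  have hx : (ofHom _ h1).Mem V := by
    rw [mem_iff]
    exact hV.range_fromSpec.le ⟨_, rfl⟩
  refine ⟨ofHom _ h1, hx, fun s => ?_⟩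
  have e1 : hV.fromSpec.appLE V ⊤ hV.fromSpec_preimage_self.ge =
      (Scheme.ΓSpecIso Γ(X.left, V)).inv := by
    rw [Scheme.Hom.appLE, hV.fromSpec_app_self, Category.assoc, ← Functor.map_comp]
    simp
  have hx' : ⊤ ≤ (Spec.map F ≫ hV.fromSpec) ⁻¹ᵁ V := hx
  have e2 : (Spec.map F ≫ hV.fromSpec).appLE V ⊤ hx' =
      hV.fromSpec.appLE V ⊤ hV.fromSpec_preimage_self.ge ≫ (Spec.map F).appTop := by
    exact ((Scheme.Hom.appLE_comp_appLE (Spec.map F) hV.fromSpec V ⊤ ⊤ _ le_top).symm.trans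
      (by rw [Scheme.Hom.appTop, Scheme.Hom.app_eq_appLE]; rfl))
  have h3 : (Spec.map F ≫ hV.fromSpec).appLE V ⊤ hx' ≫ (Scheme.ΓSpecIso (.of ℂ)).hom = F := by
    rw [e2, e1, Category.assoc, Scheme.ΓSpecIso_naturality, Iso.inv_hom_id_assoc]
  exact ConcreteCategory.congr_hom h3 s

theorem dense_setOf_mem [IsIntegral X.left] [LocallyOfFiniteType X.hom] {U : X.left.Opens}
    (hU : (U : Set X.left).Nonempty) : Dense {x : Points X | x.Mem U} := by
  intro x
  obtain ⟨_, ⟨V, hV, rfl⟩, hxV, -⟩ := X.left.isBasis_affineOpens.exists_subset_of_mem_open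
    (Set.mem_univ x.pt) isOpen_univ
  have hxV' : x.Mem V := (mem_iff _ _).2 hxV
  have : Nonempty V := ⟨⟨_, hxV⟩⟩
  -- Irreducibility makes `V` meet `U`; it remains to approach `x` in `V` by points where a nonzero
  -- `h` with basic open inside `U` does not vanish.
  obtain ⟨p, hpV, hpU⟩ : ((V ⊓ U : X.left.Opens) : Set X.left).Nonempty :=
    nonempty_preirreducible_inter V.2 U.2 ⟨_, hxV⟩ hU
  obtain ⟨h, hle, hph⟩ := hV.exists_basicOpen_le ⟨p, hpU⟩ hpV
  have hh : h ≠ 0 := by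
    rintro rfl
    simp at hph
  let := (sectionAlg V).toAlgebra
  have : Algebra.FiniteType ℂ Γ(X.left, V) := by
    have h1 := X.hom.finiteType_appLE (isAffineOpen_top SpecC) hV (le_hom_preimage_top V)
    exact h1.comp (.of_surjective _
      (ConcreteCategory.bijective_of_isIso (Scheme.ΓSpecIso (.of ℂ)).inv).2)
  let x' : Γ(X.left, V) →ₐ[ℂ] ℂ := { x.valueHom hxV' with commutes' := x.value_sectionAlg hxV' }
  obtain ⟨l, z, hz, hlim⟩ := exists_tendsto_algHom x' hh
  choose g hg hgv using fun t => exists_value_eq hV (z t).toRingHom (z t).commutes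
  have ht : Tendsto g l (𝓝 x) := tendsto_of_eval hV hxV' hg fun s => by
    simp only [hgv]
    exact hlim s
  refine mem_closure_of_tendsto ht ?_
  filter_upwards [hz] with t ht
  exact ((mem_basicOpen_iff (g t) (hg t) h).2 (by rw [hgv]; exact ht)).mono hle

end Points

end

end ProalgebraicToric

end

/-! ### The adelic torus and its lifts to the tori of covers. -/

noncomputable section

namespace ProalgebraicToric

open Topology Filter

variable {n : ℕ}

theorem torus_commute (s t : Points (torus n)) : Commute s t :=
  (torusEquiv n).injective (by rw [map_mul, map_mul, mul_comm])

/-! ### The adelic torus -/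

theorem solenoid_pow (z : solenoid) (k l : ℕ+) :
    (z : ℕ+ → ℂˣ) (k * l) ^ (l : ℕ) = (z : ℕ+ → ℂˣ) k := z.2 k l

theorem exists_solenoid_apply_eq (N : ℕ+) (u : ℂˣ) : ∃ z : solenoid, (z : ℕ+ → ℂˣ) N = u := by
  obtain ⟨w, hw⟩ : ∃ w, Complex.exp w = u := ⟨_, Complex.exp_log u.ne_zero⟩
  -- The family `exp (N w / k)` is compatible, and at `k = N` it equals `exp w = u`.
  refine ⟨⟨fun k => Units.mk0 (Complex.exp (N * w / k)) (Complex.exp_ne_zero _), fun k l => ?_⟩, ?_⟩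
  · apply Units.ext
    have hk : ((k : ℕ) : ℂ) ≠ 0 := by exact_mod_cast k.ne_zero
    have hl : ((l : ℕ) : ℂ) ≠ 0 := by exact_mod_cast l.ne_zero
    rw [Units.val_pow_eq_pow_val, Units.val_mk0, Units.val_mk0, ← Complex.exp_nat_mul]
    congr 1
    push_cast
    field_simp
  · apply Units.ext
    have hN : ((N : ℕ) : ℂ) ≠ 0 := by exact_mod_cast N.ne_zero
    rw [Units.val_mk0, mul_div_cancel_left₀ _ hN, hw]

/-- Shifting the levels by `m` extracts an `m`-th root. This divisibility is what makes lifts to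
covers unique. -/
theorem exists_solenoid_pow_eq (m : ℕ+) (z : solenoid) : ∃ w : solenoid, w ^ (m : ℕ) = z := by
  refine ⟨⟨fun k => (z : ℕ+ → ℂˣ) (k * m), fun k l => ?_⟩, ?_⟩
  · have := solenoid_pow z (k * m) l
    rwa [mul_right_comm] at this
  · apply Subtype.ext
    funext k
    exact solenoid_pow z k m

namespace AdelicTorus

theorem exists_pow_eq (m : ℕ+) (g : AdelicTorus n) : ∃ g' : AdelicTorus n, g' ^ (m : ℕ) = g := by
  choose w hw using fun i => exists_solenoid_pow_eq m (g i)
  exact ⟨w, funext hw⟩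

/-- The projection of the adelic torus to the level `N`. -/
def level (N : ℕ+) : AdelicTorus n →* Points (torus n) where
  toFun g := torusPoint fun i => (g i : ℕ+ → ℂˣ) N
  map_one' := (torusPointEquiv n).map_one
  map_mul' _ _ := torusPoint_mul _ _

theorem level_apply (N : ℕ+) (g : AdelicTorus n) :
    level N g = torusPoint fun i => (g i : ℕ+ → ℂˣ) N := rfl

theorem level_one (g : AdelicTorus n) : level 1 g = g.proj := rfl

theorem torusCoord_level (N : ℕ+) (g : AdelicTorus n) (i : Fin n) :
    torusCoord (level N g) i = (g i : ℕ+ → ℂˣ) N := by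
  rw [level_apply, torusCoord_torusPoint]

theorem level_mul_pow (k l : ℕ+) (g : AdelicTorus n) : level (k * l) g ^ (l : ℕ) = level k g := by
  have h := map_pow (torusPointEquiv n) (fun i => (g i : ℕ+ → ℂˣ) (k * l)) l
  refine h.symm.trans (congrArg torusPoint (funext fun i => ?_))
  exact solenoid_pow (g i) k l

theorem level_pow_self (N : ℕ+) (g : AdelicTorus n) : level N g ^ (N : ℕ) = g.proj := by
  have := level_mul_pow 1 N g
  rwa [one_mul] at this

theorem level_surjective (N : ℕ+) : Function.Surjective (level (n := n) N) := by
  intro t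
  choose g hg using fun i => exists_solenoid_apply_eq N (torusCoord t i)
  refine ⟨g, ?_⟩
  rw [level_apply, funext hg]
  exact torusPoint_torusCoord t

theorem continuous_level (N : ℕ+) : Continuous (level (n := n) N) :=
  continuous_torusPoint.comp (continuous_pi fun i =>
    (continuous_apply N).comp (continuous_subtype_val.comp (continuous_apply i)))

/-- A point of the adelic torus is a compatible family of points of the torus. -/
theorem exists_level_eq {s : ℕ+ → Points (torus n)} (hs : ∀ k l, s (k * l) ^ (l : ℕ) = s k) :
    ∃ g : AdelicTorus n, ∀ N, level N g = s N := by
  refine ⟨fun i => ⟨fun N => torusCoord (s N) i, fun k l => ?_⟩, fun N => ?_⟩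
  · have h := map_pow (torusPointEquiv n).symm (s (k * l)) l
    rw [hs] at h
    exact (congrFun h i).symm
  · exact torusPoint_torusCoord (s N)

theorem isEmbedding_level :
    IsEmbedding fun (g : AdelicTorus n) (N : ℕ+) => level N g := by
  let r : (ℕ+ → Points (torus n)) → Fin n → ℕ+ → ℂˣ := fun s i N => torusCoord (s N) i
  have hr : Continuous r := continuous_pi fun i => continuous_pi fun N =>
    (continuous_apply i).comp (continuous_torusCoord.comp (continuous_apply N))
  refine IsEmbedding.of_comp (continuous_pi fun N => continuous_level N) hr ?_
  have : r ∘ (fun (g : AdelicTorus n) (N : ℕ+) => level N g) =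
      Pi.map fun _ : Fin n => (Subtype.val : solenoid → ℕ+ → ℂˣ) := by
    funext g i N
    exact torusCoord_level N g i
  rw [this]
  exact IsEmbedding.piMap fun _ => IsEmbedding.subtypeVal

end AdelicTorus

/-! ### The homomorphism from the adelic torus to the torus of a cover -/

variable {X : ToricVariety n}

namespace ToricCover

theorem exists_level_data (c : ToricCover X) :
    ∃ (α β : Lattice n →* Lattice n) (N : ℕ+), c.toHom.φ = torusHom α ∧
      α.comp β = powMonoidHom (N : ℕ) ∧ β.comp α = powMonoidHom (N : ℕ) := by
  obtain ⟨α, β, N, hN, h⟩ := exists_cover_lift X c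
  exact ⟨α, β, ⟨N, hN⟩, h⟩

/-- The homomorphism of lattices inverse to that of a cover, up to isogeny. -/
def dualIsogeny (c : ToricCover X) : Lattice n →* Lattice n := c.exists_level_data.choose_spec.choose

/-- A level of the adelic torus at which the cover is dominated by a power map. -/
def degree (c : ToricCover X) : ℕ+ := c.exists_level_data.choose_spec.choose_spec.choose

theorem exists_isogeny (c : ToricCover X) :
    ∃ α : Lattice n →* Lattice n, c.toHom.φ = torusHom α ∧
      α.comp c.dualIsogeny = powMonoidHom (c.degree : ℕ) ∧
      c.dualIsogeny.comp α = powMonoidHom (c.degree : ℕ) :=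
  ⟨_, c.exists_level_data.choose_spec.choose_spec.choose_spec⟩

/-- The lift of the projection of the adelic torus to the torus of a cover. -/
def lift (c : ToricCover X) : AdelicTorus n →* Points (torus n) where
  toFun g := (AdelicTorus.level c.degree g).map (torusHom c.dualIsogeny)
  map_one' := by rw [map_one]; exact Points.map_one (torusHom c.dualIsogeny)
  map_mul' g h := by rw [map_mul]; exact Points.map_mul (torusHom c.dualIsogeny) _ _

theorem lift_apply (c : ToricCover X) (g : AdelicTorus n) :
    c.lift g = (AdelicTorus.level c.degree g).map (torusHom c.dualIsogeny) := rfl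

theorem continuous_lift (c : ToricCover X) : Continuous c.lift :=
  (Points.continuous_map _).comp (AdelicTorus.continuous_level _)

theorem lift_map_φ (c : ToricCover X) (g : AdelicTorus n) :
    (c.lift g).map c.toHom.φ = g.proj := by
  obtain ⟨α, h, -, h2⟩ := c.exists_isogeny
  rw [h, lift_apply, ← Points.map_comp, ← torusHom_comp, h2, map_torusHom_pow,
    AdelicTorus.level_pow_self]

theorem lift_surjective (c : ToricCover X) : Function.Surjective c.lift := by
  intro t
  obtain ⟨α, h, h1, -⟩ := c.exists_isogeny
  obtain ⟨g, rfl⟩ := AdelicTorus.level_surjective 1 t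
  -- With `N` the degree, `level N g` is an `N`-th root of `t`; applying `φ` and then its dual
  -- isogeny raises it back to the `N`-th power.
  obtain ⟨g', hg'⟩ := AdelicTorus.level_surjective c.degree
    ((AdelicTorus.level c.degree g).map (torusHom α))
  refine ⟨g', ?_⟩
  rw [lift_apply, hg', ← Points.map_comp, ← torusHom_comp, h1, map_torusHom_pow,
    AdelicTorus.level_pow_self, AdelicTorus.level_one]

theorem pow_degree_eq_one (c : ToricCover X) {t : Points (torus n)} (ht : t.map c.toHom.φ = 1) :
    t ^ (c.degree : ℕ) = 1 := by
  obtain ⟨α, h, h1, -⟩ := c.exists_isogeny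
  rw [← map_torusHom_pow, ← h1, torusHom_comp, Points.map_comp, ← h, ht]
  exact Points.map_one (torusHom c.dualIsogeny)

/-- The lift to the torus of a cover is unique, since the adelic torus is divisible. -/
theorem eq_lift (c : ToricCover X) (π : AdelicTorus n →* Points (torus n))
    (h : ∀ g, (π g).map c.toHom.φ = g.proj) : π = c.lift := by
  have := c.toHom.isMonHom
  ext g
  -- Two lifts differ by an element of the kernel of `φ`, which the degree kills; they agree on
  -- powers of that exponent, that is, everywhere.
  obtain ⟨g, rfl⟩ := AdelicTorus.exists_pow_eq c.degree g
  have h1 : (π g * (c.lift g)⁻¹) ^ (c.degree : ℕ) = 1 := by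
    refine c.pow_degree_eq_one ?_
    have h2 : (π g * (c.lift g)⁻¹).map c.toHom.φ * (c.lift g).map c.toHom.φ =
        (π g).map c.toHom.φ := by
      rw [← Points.map_mul c.toHom.φ, inv_mul_cancel_right]
    rw [h, lift_map_φ] at h2
    have h3 := mul_inv_eq_of_eq_mul h2.symm
    rw [← h3, mul_inv_cancel]
  rw [(torus_commute _ _).mul_pow, inv_pow, mul_inv_eq_one] at h1
  rw [map_pow, map_pow, h1]

end ToricCover

end ProalgebraicToric

end

/-! ### The action on the completion and its dense orbit. -/

noncomputable section

namespace ProalgebraicToric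

open Topology Filter

variable {n : ℕ} {X : ToricVariety n}

/-! ### The action on the completion -/

theorem ToricVariety.smul_map_orbit (X : ToricVariety n) (t s : Points (torus n)) :
    X.smul t (s.map X.orbit) = (t * s).map X.orbit := by
  have h : (t * s).map X.orbit = (Points.pair t s).map (μ[torus n] ≫ X.orbit) := by
    rw [Points.map_comp]
    rfl
  have h' : μ[torus n] ≫ X.orbit = (torus n ◁ X.orbit) ≫ X.act := X.orbit_equivariant
  rw [h, h', Points.map_comp, ToricVariety.smul_eq]
  congr 1
  have := Points.pair_map_tensorHom (𝟙 (torus n)) X.orbit t s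
  rw [id_tensorHom, Points.map_id] at this
  exact this.symm

theorem ToricHom.map_orbit {Y X : ToricVariety n} (h : ToricHom Y X) (t : Points (torus n)) :
    (t.map Y.orbit).map h.f = (t.map h.φ).map X.orbit := by
  rw [← Points.map_comp, h.orbit_comp, Points.map_comp]

theorem ToricVariety.map_orbit_injective (X : ToricVariety n) :
    Function.Injective (Points.map X.orbit) :=
  have := X.isOpenImmersion
  Points.map_injective X.orbit

theorem ToricVariety.mem_principalOrbit_iff (X : ToricVariety n) (x : Points X.X) :
    x.Mem X.principalOrbit ↔ ∃ t : Points (torus n), t.map X.orbit = x := by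
  have := X.isOpenImmersion
  exact (Set.ext_iff.1 (Points.range_map X.orbit) x).symm

namespace ToricCover

theorem φ_comp {c d : ToricCover X} (h : ToricHom c.Y d.Y) (hh : h.f ≫ d.toHom.f = c.toHom.f) :
    h.φ ≫ d.toHom.φ = c.toHom.φ := by
  have := X.isOpenImmersion
  have : Mono X.orbit := Over.mono_of_mono_left X.orbit
  rw [← cancel_mono X.orbit, Category.assoc, ← d.toHom.orbit_comp, ← c.toHom.orbit_comp,
    ← reassoc_of% h.orbit_comp, hh]

/-- Both sides lift the projection to the first level, so uniqueness applies. This makes the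
componentwise action preserve the inverse limit. -/
theorem lift_map {c d : ToricCover X} (h : ToricHom c.Y d.Y) (hh : h.f ≫ d.toHom.f = c.toHom.f)
    (g : AdelicTorus n) : (c.lift g).map h.φ = d.lift g := by
  have := h.isMonHom
  let π : AdelicTorus n →* Points (torus n) :=
    { toFun g := (c.lift g).map h.φ
      map_one' := by rw [map_one]; exact Points.map_one h.φ
      map_mul' _ _ := by rw [map_mul]; exact Points.map_mul h.φ _ _ }
  have hπ : π = d.lift := d.eq_lift π fun g => by
    change ((c.lift g).map h.φ).map d.toHom.φ = _
    rw [← Points.map_comp, φ_comp h hh, lift_map_φ]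
  exact DFunLike.congr_fun hπ g

theorem lift_powCover (N : ℕ+) (g : AdelicTorus n) :
    (powCover X N).lift g = AdelicTorus.level N g := by
  refine (DFunLike.congr_fun ((powCover X N).eq_lift (AdelicTorus.level N) fun g => ?_) g).symm
  rw [powCover_φ, map_torusHom_pow, AdelicTorus.level_pow_self]

/-- Every toric cover is dominated by the cover of the power map of any multiple of its degree. -/
theorem exists_toricHom_of_degree_dvd (c : ToricCover X) {M : ℕ+} (hM : c.degree ∣ M) :
    ∃ h : ToricHom (powCover X M).Y c.Y, h.f ≫ c.toHom.f = (powCover X M).toHom.f := by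
  obtain ⟨α, hα, -, h2⟩ := c.exists_isogeny
  obtain ⟨l, rfl⟩ := hM
  obtain ⟨k, hk, -⟩ := exists_toricHom_powCover X c (N := c.degree * l)
    -- Scaling the dual isogeny by `l` changes the degree `N` into `N * l`.
    (β := (powMonoidHom (l : ℕ)).comp c.dualIsogeny) hα (by
      rw [MonoidHom.comp_assoc, h2]
      ext m
      simp [pow_mul])
  exact ⟨k, hk⟩

end ToricCover

namespace Completion

theorem proj_map (x : Completion X) {c d : ToricCover X} (h : ToricHom c.Y d.Y)
    (hh : h.f ≫ d.toHom.f = c.toHom.f) : (x.proj c).map h.f = x.proj d := x.2 c d h hh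

theorem proj_map_toHom (x : Completion X) (c : ToricCover X) :
    (x.proj c).map c.toHom.f = x.proj (ToricCover.trivial X) :=
  x.proj_map (c := c) (d := ToricCover.trivial X) c.toHom (Category.comp_id c.toHom.f)

theorem ext {x y : Completion X} (h : ∀ c, x.proj c = y.proj c) : x = y :=
  Subtype.ext (funext h)

theorem continuous_proj (c : ToricCover X) : Continuous (proj c) :=
  (continuous_apply c).comp continuous_subtype_val

/-- The action of the adelic torus on the completion. -/
@[reducible]
def mulAction (X : ToricVariety n) : MulAction (AdelicTorus n) (Completion X) where
  smul g x := ⟨fun c => c.Y.smul (c.lift g) (x.proj c), fun c d h hh => by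
    rw [h.map_smul, ToricCover.lift_map h hh, x.proj_map h hh]⟩
  one_smul x := ext fun c => by
    change c.Y.smul (c.lift 1) (x.proj c) = x.proj c
    rw [map_one]
    exact c.Y.one_smul _
  mul_smul g h x := ext fun c => by
    change c.Y.smul (c.lift (g * h)) (x.proj c) =
      c.Y.smul (c.lift g) (c.Y.smul (c.lift h) (x.proj c))
    rw [map_mul]
    exact c.Y.mul_smul _ _ _

attribute [local instance] mulAction

theorem proj_smul (g : AdelicTorus n) (x : Completion X) (c : ToricCover X) :
    (g • x).proj c = c.Y.smul (c.lift g) (x.proj c) := rfl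

theorem continuousSMul : ContinuousSMul (AdelicTorus n) (Completion X) := by
  have hc (c : ToricCover X) : Continuous fun p : AdelicTorus n × Completion X =>
      c.Y.smul (c.lift p.1) (p.2.proj c) := by
    have h1 : Continuous fun p : AdelicTorus n × Completion X => (c.lift p.1, p.2.proj c) :=
      (c.continuous_lift.comp continuous_fst).prodMk ((continuous_proj c).comp continuous_snd)
    exact Continuous.comp (g := fun q : Points (torus n) × Points c.Y.X => c.Y.smul q.1 q.2)
      (f := fun p : AdelicTorus n × Completion X => (c.lift p.1, p.2.proj c))
      c.Y.continuous_smul h1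
  have h : Continuous fun p : AdelicTorus n × Completion X => (p.1 • p.2).1 := continuous_pi hc
  exact ⟨continuous_induced_rng.2 h⟩

/-- The base point of the completion. -/
def basePoint (X : ToricVariety n) : Completion X :=
  ⟨fun c => (1 : Points (torus n)).map c.Y.orbit, fun c d h _ => by
    have := h.isMonHom
    rw [h.map_orbit]
    exact congrArg _ (Points.map_one h.φ)⟩

theorem proj_smul_basePoint (g : AdelicTorus n) (c : ToricCover X) :
    (g • basePoint X).proj c = (c.lift g).map c.Y.orbit := by
  rw [proj_smul]
  refine (c.Y.smul_map_orbit _ _).trans ?_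
  exact congrArg _ (mul_one (c.lift g))

theorem orbit_basePoint : MulAction.orbit (AdelicTorus n) (basePoint X) =
    {x | (x.proj (ToricCover.trivial X)).Mem X.principalOrbit} := by
  ext x
  constructor
  · rintro ⟨g, rfl⟩
    exact (X.mem_principalOrbit_iff _).2 ⟨_, (proj_smul_basePoint g (ToricCover.trivial X)).symm⟩
  · intro hx
    have H (c : ToricCover X) : ∃ t : Points (torus n), t.map c.Y.orbit = x.proj c := by
      rw [← c.Y.mem_principalOrbit_iff, ← c.preimage, ← Points.mem_map_iff, proj_map_toHom]
      exact hx
    choose t ht using H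
    have htc {c d : ToricCover X} (h : ToricHom c.Y d.Y) (hh : h.f ≫ d.toHom.f = c.toHom.f) :
        (t c).map h.φ = t d := by
      apply d.Y.map_orbit_injective
      rw [← h.map_orbit, ht, ht, x.proj_map h hh]
    -- The maps between power covers raise torus coordinates to powers, so these coordinates form a
    -- point of the adelic torus; the other covers follow by domination.
    obtain ⟨g, hg⟩ := AdelicTorus.exists_level_eq (s := fun N => t (powCover X N)) fun k l => by
      obtain ⟨h, hh, hφ⟩ := exists_toricHom_powCover X (powCover X k) (N := k * l)
        (β := powMonoidHom (l : ℕ)) (powCover_φ X k) (by ext m; simp [pow_mul])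
      rw [← htc h hh, hφ, map_torusHom_pow]
    refine ⟨g, ext fun c => ?_⟩
    obtain ⟨h, hh⟩ := c.exists_toricHom_of_degree_dvd dvd_rfl
    change (g • basePoint X).proj c = _
    rw [proj_smul_basePoint, ← ToricCover.lift_map h hh, ToricCover.lift_powCover, hg, htc h hh, ht]

theorem isOpenEmbedding_smul_basePoint :
    IsOpenEmbedding fun g : AdelicTorus n => g • basePoint X := by
  have := continuousSMul (X := X)
  -- The projections to the power covers alone already recover the topology of the adelic torus.
  let Ψ : Completion X → (N : ℕ+) → Points (powCover X N).Y.X := fun x N => x.proj (powCover X N)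
  have hΨ : Continuous Ψ := continuous_pi fun N => continuous_proj _
  refine ⟨IsEmbedding.of_comp (continuous_id.smul continuous_const) hΨ ?_, ?_⟩
  · have h : Ψ ∘ (fun g : AdelicTorus n => g • basePoint X) =
        (Pi.map fun N : ℕ+ => Points.map (powCover X N).Y.orbit) ∘
          (fun (g : AdelicTorus n) (N : ℕ+) => AdelicTorus.level N g) := by
      funext g N
      exact (proj_smul_basePoint g (powCover X N)).trans
        (congrArg _ (ToricCover.lift_powCover N g))
    rw [h]
    refine IsEmbedding.comp (IsEmbedding.piMap fun N => ?_) AdelicTorus.isEmbedding_level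
    have := (powCover X N).Y.isOpenImmersion
    exact (Points.isOpenEmbedding_map (powCover X N).Y.orbit).isEmbedding
  · change IsOpen (MulAction.orbit (AdelicTorus n) (basePoint X))
    rw [orbit_basePoint]
    exact (Points.isOpen_setOf_mem _).preimage (continuous_proj (ToricCover.trivial X))

theorem dense_orbit_basePoint : Dense (MulAction.orbit (AdelicTorus n) (basePoint X)) := by
  rw [dense_iff_inter_open]
  rintro _ ⟨W, hW, rfl⟩ ⟨x, hx⟩
  obtain ⟨I, u, hu, hI⟩ := isOpen_pi_iff.1 hW x.1 hx
  -- A common multiple of the degrees, so that one power cover dominates all the covers in `I`.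
  let M : ℕ+ := ∏ c ∈ I, c.degree
  have H (c : I) : ∃ h : ToricHom (powCover X M).Y c.1.Y,
      h.f ≫ c.1.toHom.f = (powCover X M).toHom.f :=
    c.1.exists_toricHom_of_degree_dvd (Finset.dvd_prod_of_mem _ c.2)
  choose h hh using H
  let V : Set (Points (powCover X M).Y.X) := ⋂ c : I, (Points.map (h c).f) ⁻¹' (u c.1)
  have hV : IsOpen V := isOpen_iInter_of_finite fun c =>
    (hu c.1 c.2).1.preimage (Points.continuous_map _)
  have hxV : x.proj (powCover X M) ∈ V := Set.mem_iInter.2 fun c => by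
    rw [Set.mem_preimage, x.proj_map (h c) (hh c)]
    exact (hu c.1 c.2).2
  have := (powCover X M).Y.integral
  have := (powCover X M).Y.finiteType
  have := (powCover X M).Y.isOpenImmersion
  obtain ⟨y, hyV, hy⟩ := (Points.dense_setOf_mem (X := (powCover X M).Y.X)
    (U := (powCover X M).Y.principalOrbit) (Set.range_nonempty _)).inter_open_nonempty V hV ⟨_, hxV⟩
  obtain ⟨t, rfl⟩ := ((powCover X M).Y.mem_principalOrbit_iff y).1 hy
  obtain ⟨g, rfl⟩ := (powCover X M).lift_surjective t
  refine ⟨g • basePoint X, hI fun c hc => ?_, g, rfl⟩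
  have h1 := Set.mem_iInter.1 hyV ⟨c, hc⟩
  rw [← proj_smul_basePoint, Set.mem_preimage, proj_map _ _ (hh ⟨c, hc⟩)] at h1
  exact h1

end Completion

end ProalgebraicToric

end

theorem mainTheorem7 {n : ℕ} (X : ProalgebraicToric.ToricVariety n) :
    -- `X_ℚ` carries a continuous action of the adelic torus
    ∃ _ : MulAction (ProalgebraicToric.AdelicTorus n) (ProalgebraicToric.Completion X),
      ContinuousSMul (ProalgebraicToric.AdelicTorus n) (ProalgebraicToric.Completion X) ∧
      -- for every toric cover `Y ⟶ X`, the projection `X_ℚ → Y(ℂ)` is equivariant along a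
      -- continuous epimorphism onto the torus of `Y` that lifts `(ℂ*_ℚ)ⁿ → (ℂ*)ⁿ`
      (∀ c : ProalgebraicToric.ToricCover X,
        ∃ π : ProalgebraicToric.AdelicTorus n →*
            ProalgebraicToric.Points (ProalgebraicToric.torus n),
          Continuous π ∧ Function.Surjective π ∧
          (∀ g, (π g).map c.toHom.φ = g.proj) ∧
          ∀ (g : ProalgebraicToric.AdelicTorus n) (x : ProalgebraicToric.Completion X),
            (g • x).proj c = c.Y.smul (π g) (x.proj c)) ∧
      -- the part of `X_ℚ` over the principal orbit of `X` is a single free orbit, homeomorphic to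
      -- the adelic torus, open and dense
      ∃ x₀ : ProalgebraicToric.Completion X,
        MulAction.orbit (ProalgebraicToric.AdelicTorus n) x₀ =
          {x | (x.proj (ProalgebraicToric.ToricCover.trivial X)).Mem X.principalOrbit} ∧
        Dense (MulAction.orbit (ProalgebraicToric.AdelicTorus n) x₀) ∧
        Topology.IsOpenEmbedding
          (fun g : ProalgebraicToric.AdelicTorus n => g • x₀) := by
  exact ⟨ProalgebraicToric.Completion.mulAction X,
    ProalgebraicToric.Completion.continuousSMul,
    fun c => ⟨c.lift, c.continuous_lift, c.lift_surjective, c.lift_map_φ,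
      fun g x => ProalgebraicToric.Completion.proj_smul g x c⟩,
    ProalgebraicToric.Completion.basePoint X,
    ProalgebraicToric.Completion.orbit_basePoint,
    ProalgebraicToric.Completion.dense_orbit_basePoint,
    ProalgebraicToric.Completion.isOpenEmbedding_smul_basePoint⟩
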